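/- **Conventions.** A Boolean circuit on $n$ variables $x_1,\dots,x_n$ is a directed acyclic graph with a unique sink (the output gate) whose sources are labelled by literals $x_i$ or $\neg x_i$ and whose other nodes are $\wedge$ or $\vee$ gates of arbitrary fan-in at least one; its size $s$ is its number of gates (input gates included). The depth of a gate is the maximal number of $\wedge$ and $\vee$ gates on a path from an input gate to it, inclusive; the depth of a circuit is that of its output gate. A formula is a circuit in which every gate other than the output gate has out-degree exactly one. A $\vee\wedge\vee\wedge$ formula is a formula of depth four whose gates of depth $4,3,2,1$ are $\vee,\wedge,\vee,\wedge$ gates, respectively. Circuits are evaluated on inputs from $\{u,0,1\}^n$ by Kleene's three-valued rules ($\neg u=u$; an $\wedge$ gate has value $0$ if some input is $0$, value $1$ if all inputs are $1$, and $u$ otherwise; dually for $\vee$). A resolution of $a\in\{u,0,1\}^n$ is a $b\in\{0,1\}^n$ that agrees with $a$ wherever $a_i\neq u$. A circuit $C$ has a hazard if there are $a\in\{u,0,1\}^n$ and $v\in\{0,1\}$ such that $C(a)=u$ but $C(b)=v$ for all resolutions $b$ of $a$. $\mathrm{HAZARD}$ is the language of all circuits that have hazards. Algorithms are deterministic multitape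 Turing machines, with instances written as words over a finite alphabet (numbers in unary). **SETH** is the hypothesis that for every $\varepsilon>0$ there is an integer $k\ge 3$ such that no algorithm decides the satisfiability of CNF formulas on $n$ variables, with at most $k$ literals per clause and no repeated clauses, in time $O(2^{(1-\varepsilon)n})$. **Theorem.** Assume SETH. Then for every $\varepsilon>0$ there is no algorithm for $\mathrm{HAZARD}$ running in time $O(3^{(1-\varepsilon)n}\,\mathrm{poly}(s))$, where $n$ is the number of variables and $s$ the size of the input circuit. This holds even if the algorithm has to be correct and to meet the time bound only on inputs that are formulas of depth four, and even only on $\vee\wedge\vee\wedge$ formulas. -/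

import Mathlib

namespace HazardDetection

/-! ### Ternary logic -/

/-- The stable values `0`, `1` and the unstable value `u`. -/
inductive Ternary
  | zero
  | one
  | u
  deriving DecidableEq

namespace Ternary

/-- A stable value as a ternary value. -/
def ofBool : Bool → Ternary
  | false => zero
  | true => one

/-- Truth table of the NOT gate. -/
def not : Ternary → Ternary
  | zero => one
  | one => zero
  | u => u

/-- Truth table of the AND gate. -/
def and : Ternary → Ternary → Ternary
  | zero, _ => zero
  | _, zero => zero
  | one, one => one
  | one, u => u
  | u, one => u
  | u, u => u

/-- Truth table of the OR gate. -/
def or : Ternary → Ternary → Ternary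
  | one, _ => one
  | _, one => one
  | zero, zero => zero
  | zero, u => u
  | u, zero => u
  | u, u => u

/-- AND of arbitrary fan-in. -/
def bigAnd (l : List Ternary) : Ternary := l.foldr and one

/-- OR of arbitrary fan-in. -/
def bigOr (l : List Ternary) : Ternary := l.foldr or zero

end Ternary

/-! ### Circuits -/

/-- A gate of a circuit on the variables `x_0, …, x_{n-1}` whose gates are numbered `0, 1, 2, …`:
an input gate, labelled by the literal `x_i` (`pos = true`) or `¬ x_i` (`pos = false`), or an AND
or OR gate, given by the numbers of the gates that feed into it. -/
inductive Gate (n : ℕ)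
  | lit (i : Fin n) (pos : Bool)
  | and (ins : List ℕ)
  | or (ins : List ℕ)

namespace Gate

variable {n : ℕ}

/-- The numbers of the gates that feed into a gate. -/
def inputs : Gate n → List ℕ
  | lit _ _ => []
  | and ins => ins
  | or ins => ins

/-- The value of a gate on the input `x`, given the list of values of the preceding gates. -/
def value (x : Fin n → Ternary) (prev : List Ternary) : Gate n → Ternary
  | lit i pos => if pos then x i else (x i).not
  | and ins => Ternary.bigAnd (ins.map fun j => prev.getD j .u)
  | or ins => Ternary.bigOr (ins.map fun j => prev.getD j .u)

/-- The depth of a gate, given the list of depths of the preceding gates: the maximal number of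
AND and OR gates on a path from an input gate to this gate, inclusive. -/
def depth (prev : List ℕ) : Gate n → ℕ
  | lit _ _ => 0
  | and ins => (ins.map fun j => prev.getD j 0).foldr max 0 + 1
  | or ins => (ins.map fun j => prev.getD j 0).foldr max 0 + 1

end Gate

/-- A Boolean circuit on `n` variables: a directed acyclic graph with a unique sink, whose sources
are labelled by literals and whose other nodes are AND or OR gates of arbitrary fan-in. The gates
are listed in a topological order, so that the sink (the output gate) is the last one. -/
structure Circuit (n : ℕ) where
  /-- the gates -/
  gates : List (Gate n)
  gates_ne : gates ≠ []
  acyclic : ∀ (i : ℕ) (h : i < gates.length), ∀ j ∈ gates[i].inputs, j < i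
  inputs_nodup : ∀ g ∈ gates, g.inputs.Nodup
  inputs_ne : ∀ g ∈ gates, g ≠ Gate.and [] ∧ g ≠ Gate.or []
  unique_sink : ∀ j, j + 1 < gates.length → ∃ g ∈ gates, j ∈ g.inputs

namespace Circuit

variable {n : ℕ} (C : Circuit n)

/-- The size of a circuit: its number of gates, input gates included. -/
def size : ℕ := C.gates.length

/-- The values of all gates on the input `x`, in the order of the gates. -/
def values (x : Fin n → Ternary) : List Ternary :=
  C.gates.foldl (fun prev g => prev ++ [g.value x prev]) []

/-- The value `C(x)` of the output gate on the input `x`. -/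
def eval (x : Fin n → Ternary) : Ternary := (C.values x).getLastD .u

/-- The depths of all gates, in the order of the gates. -/
def depths : List ℕ :=
  C.gates.foldl (fun prev g => prev ++ [g.depth prev]) []

/-- The depth of a circuit is the depth of its output gate. -/
def depth : ℕ := C.depths.getLastD 0

/-- A formula is a circuit in which every gate other than the output gate has out-degree exactly
one. -/
def IsFormula : Prop :=
  ∀ j, j + 1 < C.gates.length → C.gates.countP (fun g => decide (j ∈ g.inputs)) = 1

/-- `∨∧∨∧` formulas: formulas of depth four in which, from the output gate down, the gates of depth
four are OR gates, those of depth three AND gates, those of depth two OR gates and those of depth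
one AND gates. -/
def IsOrAndOrAnd : Prop :=
  C.IsFormula ∧ C.depth = 4 ∧
    ∀ (i : ℕ) (h : i < C.gates.length),
      match C.gates[i] with
      | .lit _ _ => True
      | .and _ => C.depths.getD i 0 = 3 ∨ C.depths.getD i 0 = 1
      | .or _ => C.depths.getD i 0 = 4 ∨ C.depths.getD i 0 = 2

end Circuit

/-! ### Hazards -/

/-- `b` is a resolution of `a`: it arises from `a` by changing only unstable values, to stable
ones. -/
def IsResolution {n : ℕ} (a : Fin n → Ternary) (b : Fin n → Bool) : Prop :=
  ∀ i, a i ≠ .u → a i = Ternary.ofBool (b i)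

namespace Circuit

variable {n : ℕ} (C : Circuit n)

/-- `C` has a `v`-hazard on the input `a`, for `v ∈ {0, 1}`. -/
def HasHazardAt (v : Bool) (a : Fin n → Ternary) : Prop :=
  C.eval a = .u ∧
    ∀ b : Fin n → Bool, IsResolution a b → C.eval (fun i => .ofBool (b i)) = .ofBool v

/-- `C` has a `1`-hazard or a `0`-hazard. -/
def HasHazard : Prop :=
  (∃ a, C.HasHazardAt true a) ∨ (∃ a, C.HasHazardAt false a)

end Circuit

/-! ### Formulas in conjunctive normal form -/

/-- A literal over `n` variables: a variable together with its sign (`true` for `x_i`, `false` for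
`¬ x_i`). -/
abbrev Literal (n : ℕ) := Fin n × Bool

/-- A CNF formula on `n` variables. As it is a set of clauses, no clause is listed twice. -/
structure CNF (n : ℕ) where
  /-- the clauses -/
  clauses : List (List (Literal n))
  clauses_nodup : clauses.Nodup

namespace CNF

variable {n : ℕ} (F : CNF n)

/-- Every clause has at most `k` literals. -/
def IsWidth (k : ℕ) : Prop := ∀ c ∈ F.clauses, c.length ≤ k

/-- Some assignment makes a literal of every clause true. -/
def Satisfiable : Prop :=
  ∃ y : Fin n → Bool, ∀ c ∈ F.clauses, ∃ l ∈ c, y l.1 = l.2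

end CNF

/-! ### Encodings of the instances as words

Numbers are written in unary. -/

/-- The input alphabet. -/
inductive Symb
  | tally
  | pos
  | neg
  | and
  | or
  | wire

/-- A number in unary. -/
def unary (m : ℕ) : List Symb := List.replicate m Symb.tally

/-- The word for a literal: its sign, followed by the index of its variable. -/
def encodeLit {n : ℕ} (i : Fin n) (pos : Bool) : List Symb :=
  (if pos then Symb.pos else Symb.neg) :: unary i

/-- The word for the list of gates that feed into a gate. -/
def encodeWires (ins : List ℕ) : List Symb := ins.flatMap fun j => Symb.wire :: unary j

/-- The word for a gate. -/
def Gate.encode {n : ℕ} : Gate n → List Symb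
  | .lit i pos => encodeLit i pos
  | .and ins => Symb.and :: encodeWires ins
  | .or ins => Symb.or :: encodeWires ins

/-- The word for a circuit: the number of variables, followed by the gates in order. -/
def encodeCircuit (C : Σ n, Circuit n) : List Symb :=
  unary C.1 ++ C.2.gates.flatMap Gate.encode

/-- The word for a CNF formula: the number of variables, followed by the clauses. -/
def encodeCNF (F : Σ n, CNF n) : List Symb :=
  unary F.1 ++ F.2.clauses.flatMap fun c => Symb.or :: c.flatMap fun l => encodeLit l.1 l.2

/-! ### Algorithms and running times -/

open Classical in
/-- Some algorithm decides, for each instance `x` in `S`, whether `x ∈ L`, in at most `T x` steps;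
nothing is asked of it on other instances. Algorithms are deterministic Turing machines with
finitely many stacks (equivalently, tapes), over finite alphabets; such a machine is started on the
word that encodes `x`, and it has to halt with the one-symbol output `true` or `false`. -/
def DecidableInTime {α : Type} (enc : α → List Symb) (S L : Set α) (T : α → ℝ) : Prop :=
  ∃ M : Turing.TM2ComputableAux Symb Bool,
    (∀ k, Finite (M.tm.Γ k)) ∧
    ∀ x ∈ S, ∃ t : ℕ, (t : ℝ) ≤ T x ∧
      Nonempty (Turing.TM2OutputsInTime M.tm ((enc x).map M.inputAlphabet.symm)
        (some ([decide (x ∈ L)].map M.outputAlphabet.symm)) t)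

/-- The satisfiable CNF formulas. -/
def CNFSAT : Set (Σ n, CNF n) := {F | F.2.Satisfiable}

/-- The strong exponential time hypothesis: for every `ε > 0` there is an integer `k ≥ 3` such that
no algorithm solves `k`-CNFSAT on `n` variables in time `O(2 ^ ((1 - ε) n))`. -/
def SETH : Prop :=
  ∀ ε : ℝ, 0 < ε → ∃ k : ℕ, 3 ≤ k ∧
    ¬ ∃ K : ℝ, DecidableInTime encodeCNF {F | F.2.IsWidth k} CNFSAT
      (fun F => K * (2 : ℝ) ^ ((1 - ε) * (F.1 : ℝ)))

/-- The language of all circuits that have hazards. -/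
def HAZARD : Set (Σ n, Circuit n) := {C | C.2.HasHazard}

/-- Some algorithm solves `HAZARD` on all inputs from `S` in time `O(3 ^ ((1 - ε) n) poly(s))`,
where `n` is the number of variables and `s` the size of the input circuit. -/
def HazardSolvableInTime (S : Set (Σ n, Circuit n)) (ε : ℝ) : Prop :=
  ∃ (K : ℝ) (d : ℕ), DecidableInTime encodeCircuit S HAZARD
    (fun C => K * (3 : ℝ) ^ ((1 - ε) * (C.1 : ℝ)) * (C.2.size : ℝ) ^ d)

end HazardDetection

/-!
The lower bound comes from a reduction of `k`-CNF satisfiability to hazard detection that maps `n`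
Boolean variables to about `n / log₂ 3` ternary ones and produces `∨∧∨∧` formulas of polynomial
size. Then `3 ^ ((1 - ε) m)`, for the number `m` of variables of the formula, is about
`2 ^ ((1 - ε) n)`, and a fast algorithm for hazards contradicts SETH. The statements on formulas of depth
four and on all circuits follow, since they concern larger sets of instances.

*Encoding.* The Boolean variables are divided into blocks of `P`, and each block is encoded by `q`
ternary variables. The code words are the words of length `q` with `i` ones and `j` zeros, for
suitable `i` and `j`. There are only `(q + 1) ^ 2` pairs `(i, j)`, so one of them is attained by
at least `3 ^ q / (q + 1) ^ 2` words, and these can encode `P` bits where `2 ^ P` is at least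
`3 ^ (δ q)`, for any given `δ < 1` and a suitable `q` (`exists_blockCode`). The code words are the
prime implicants of the condition "at least `i` ones and at least `j` zeros"; in the sense of
Kleene's logic, the disjunction of these terms has the value `1` on a word if and only if the
condition holds for all resolutions of that word (`covers_full_of_resolutions`).

*Formula.* The formula is a disjunction. Each disjunct contains, for all blocks, the condition of
the block, as a disjunction of terms. In addition, the first disjunct demands that some block
refines a word with one more stable position than a code word, and the disjunct for a clause `C`
demands, for each literal of `C`, that the block of its variable refines a code word by which this
literal becomes false. On Boolean inputs the first disjunct is equivalent to the conjunction of
the conditions of the blocks, because a code word has an unstable position; hence so is the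
formula. On a ternary input all of whose resolutions have the value `1`, the blocks satisfy their
conditions. Therefore the formula has a hazard there if and only if all blocks are code words and
the assignment that they encode falsifies no clause. There are no hazards for the value `0`: if no
disjunct has the value `0`, then each block is compatible with a code word, and resolving the
input accordingly yields the value `1` (`not_hasHazardAt_false`). So the formula has a hazard if
and only if the CNF formula is satisfiable (`hasHazard_circuit_iff`).

*Running time.* The reduction has to be carried out by a machine. It is written in a small
language of structured programs on stacks, which are compiled to the machines of Mathlib and
composed with the given machine for hazards (`DecidableInTime.of_reduction`). The program writes
the gates of the formula in postorder; for every level of the formula, a stack holds the numbers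
of those gates that still have to be connected to a gate of the next level. Its running time is
polynomial in the size of the formula (`runs_reductionProg`). This size is polynomial in `n`, as
there are only polynomially many clauses of width `k` (`exists_length_lay_formula_le`).
-/

namespace HazardDetection

open Turing StateTransition

/-! ### Stack programs and their Turing machines -/

/-- Structured programs that work on stacks of symbols, one for each element of `K`. -/
inductive Prog (K : Type)
  /-- do nothing -/
  | skip
  /-- push the symbol `a` on the stack `k` -/
  | push (k : K) (a : Symb)
  /-- remove the top of the stack `k` -/
  | pop (k : K)
  /-- run two programs one after the other -/
  | seq (p q : Prog K)
  /-- branch on the top of the stack `k` -/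
  | case (k : K) (ps : Option Symb → Prog K)
  /-- repeat `p` as long as the top of the stack `k` satisfies `c` -/
  | loop (k : K) (c : Option Symb → Bool) (p : Prog K)

namespace Prog

variable {K : Type} [DecidableEq K]

/-- `p.Runs S S' t`: started on the stacks `S`, the program `p` halts after at most `t` steps, with
the stacks `S'`. -/
inductive Runs : Prog K → (K → List Symb) → (K → List Symb) → ℕ → Prop
  | skip (S) : Runs skip S S 1
  | push (k a S) : Runs (push k a) S (Function.update S k (a :: S k)) 1
  | pop (k S) : Runs (pop k) S (Function.update S k (S k).tail) 1
  | seq {p q S S' S'' t t'} : Runs p S S' t → Runs q S' S'' t' → Runs (seq p q) S S'' (t + t')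
  | case {k ps S S' t} : Runs (ps (S k).head?) S S' t → Runs (case k ps) S S' (t + 1)
  | loop_exit {k c p S} : c (S k).head? = false → Runs (loop k c p) S S 1
  | loop_step {k c p S S' S'' t t'} : c (S k).head? = true → Runs p S S' t →
      Runs (loop k c p) S' S'' t' → Runs (loop k c p) S S'' (t + t' + 1)
  | mono {p S S' t t'} : Runs p S S' t → t ≤ t' → Runs p S S' t'

omit [DecidableEq K] in
theorem _root_.HazardDetection.finite_symb : Finite Symb := by
  refine Finite.of_injective (β := Fin 6)
    (fun a => match a with
      | .tally => 0 | .pos => 1 | .neg => 2 | .and => 3 | .or => 4 | .wire => 5) ?_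
  intro a b
  cases a <;> cases b <;> simp

/-- A step makes a stack at most one symbol longer. -/
theorem Runs.length_le {p : Prog K} {S S' : K → List Symb} {t : ℕ} (h : p.Runs S S' t) (k : K) :
    (S' k).length ≤ (S k).length + t := by
  induction h with
  | skip => simp
  | push k' a S =>
    by_cases hk : k = k'
    · subst hk; simp
    · simp [hk]
  | pop k' S =>
    by_cases hk : k = k'
    · subst hk; simp; omega
    · simp [hk]
  | seq _ _ ih ih' => omega
  | case _ ih => omega
  | loop_exit => simp
  | loop_step _ _ _ ih ih' => omega
  | mono _ _ ih => omega

/-- The control states of the machine for a program. -/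
def Lab : Prog K → Type
  | skip => Unit
  | push _ _ => Unit
  | pop _ => Unit
  | seq p q => p.Lab ⊕ q.Lab
  | case _ ps => Option (Σ o, (ps o).Lab)
  | loop _ _ p => Option p.Lab

omit [DecidableEq K] in
theorem finite_lab (p : Prog K) : Finite p.Lab := by
  induction p with
  | skip => exact inferInstanceAs (Finite Unit)
  | push => exact inferInstanceAs (Finite Unit)
  | pop => exact inferInstanceAs (Finite Unit)
  | seq p q ihp ihq => exact inferInstanceAs (Finite (p.Lab ⊕ q.Lab))
  | case k ps ih =>
    have := finite_symb
    exact inferInstanceAs (Finite (Option (Σ o, (ps o).Lab)))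
  | loop k c p ih => exact inferInstanceAs (Finite (Option p.Lab))

/-- The control state in which the machine for a program starts. -/
def entry : (p : Prog K) → p.Lab
  | skip => ()
  | push _ _ => ()
  | pop _ => ()
  | seq p _ => Sum.inl p.entry
  | case _ _ => none
  | loop _ _ _ => none

section Compile

variable {L : Type} (Γ : L → Type) (τ : Type)

/-- The alphabets of the stacks of a composed machine: stacks of symbols, followed by the stacks of
another machine. -/
abbrev StackAlphabet (K : Type) (Γ : L → Type) : K ⊕ L → Type := Sum.elim (fun _ => Symb) Γ

/-- The stacks of a composed machine. -/
def join {Γ : L → Type} (S : K → List Symb) (T : ∀ l, List (Γ l)) :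
    ∀ k, List (StackAlphabet K Γ k)
  | .inl k => S k
  | .inr l => T l

/-- The machine code of a program. Its control states are embedded by `e` into those of a larger
machine, and `x` is the control state in which that machine continues. The internal state has a
component for the symbol read last. -/
def code {Λ : Type} : (p : Prog K) → (p.Lab → Λ) → Λ → p.Lab →
    TM2.Stmt (StackAlphabet K Γ) Λ (Option Symb × τ)
  | skip, _, x => fun _ => .goto fun _ => x
  | push k a, _, x => fun _ => .push (.inl k) (fun _ => a) (.goto fun _ => x)
  | pop k, _, x => fun _ => .pop (.inl k) (fun v _ => v) (.goto fun _ => x)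
  | seq p q, e, x => fun l => match l with
    | .inl l => code p (fun l => e (.inl l)) (e (.inr q.entry)) l
    | .inr l => code q (fun l => e (.inr l)) x l
  | case k ps, e, x => fun l => match l with
    | none => .peek (.inl k) (fun v o => (o, v.2)) (.goto fun v => e (some ⟨v.1, (ps v.1).entry⟩))
    | some ⟨o, l⟩ => code (ps o) (fun l => e (some ⟨o, l⟩)) x l
  | loop k c p, e, x => fun l => match l with
    | none => .peek (.inl k) (fun v o => (o, v.2))
        (.goto fun v => if c v.1 then e (some p.entry) else x)
    | some l => code p (fun l => e (some l)) (e none) l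

variable [DecidableEq L] {Γ τ}

omit [DecidableEq K] [DecidableEq L] in
theorem code_case_none {Λ : Type} (k : K) (ps : Option Symb → Prog K)
    (e : (case k ps).Lab → Λ) (x : Λ) :
    code Γ τ (case k ps) e x none = .peek (.inl k) (fun v o => (o, v.2))
      (.goto fun v => e (some ⟨v.1, (ps v.1).entry⟩)) := by
  rw [code]

omit [DecidableEq K] [DecidableEq L] in
theorem code_case_some {Λ : Type} (k : K) (ps : Option Symb → Prog K)
    (e : (case k ps).Lab → Λ) (x : Λ) (o : Option Symb) (l : (ps o).Lab) :
    code Γ τ (case k ps) e x (some ⟨o, l⟩) = code Γ τ (ps o) (fun l => e (some ⟨o, l⟩)) x l := by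
  rw [code]

theorem update_join_inl (S : K → List Symb) (T : ∀ l, List (Γ l)) (k : K) (s : List Symb) :
    Function.update (join S T) (.inl k) s = join (Function.update S k s) T := by
  refine Function.update_eq_iff.2 ⟨(Function.update_self k s S).symm, ?_⟩
  rintro (i | i) h
  · exact (Function.update_of_ne (fun h' => h (congrArg _ h')) s S).symm
  · rfl

theorem update_join_inr (S : K → List Symb) (T : ∀ l, List (Γ l)) (l : L) (s : List (Γ l)) :
    Function.update (join S T) (.inr l) s = join S (Function.update T l s) := by
  refine Function.update_eq_iff.2 ⟨(Function.update_self l s T).symm, ?_⟩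
  rintro (i | i) h
  · rfl
  · exact (Function.update_of_ne (fun h' => h (congrArg _ h')) s T).symm

theorem update_nil_inl (k : K) (s : List Symb) :
    (Function.update (fun _ => []) (.inl k) s : ∀ i, List (StackAlphabet K Γ i)) =
      join (Function.update (fun _ => []) k s) (fun _ => []) := by
  refine Eq.trans ?_ (update_join_inl _ _ k s)
  congr 1
  funext i
  cases i <;> rfl

theorem update_nil_inr (l : L) (s : List (Γ l)) :
    (Function.update (fun _ => []) (.inr l) s : ∀ i, List (StackAlphabet K Γ i)) =
      join (fun _ => []) (Function.update (fun _ => []) l s) := by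
  refine Eq.trans ?_ (update_join_inr _ _ l s)
  congr 1
  funext i
  cases i <;> rfl

omit [DecidableEq K] [DecidableEq L] in
theorem step_some {K' Λ σ : Type} [DecidableEq K'] {Δ : K' → Type} (m : Λ → TM2.Stmt Δ Λ σ) (l : Λ)
    (v : σ) (S : ∀ k, List (Δ k)) (q : TM2.Stmt Δ Λ σ) (c : TM2.Cfg Δ Λ σ) (hq : m l = q)
    (hc : TM2.stepAux q v S = c) : TM2.step m ⟨some l, v, S⟩ = some c := by
  subst hq hc
  rfl

theorem stepAux_pop_inl {Λ : Type} (k : K) (q : TM2.Stmt (StackAlphabet K Γ) Λ (Option Symb × τ))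
    (v : Option Symb × τ) (S : K → List Symb) (T : ∀ l, List (Γ l)) {s : List Symb} (hs : S k = s) :
    TM2.stepAux (.pop (.inl k) (fun v o => (o, v.2)) q) v (join S T) =
      TM2.stepAux q (s.head?, v.2) (join (Function.update S k s.tail) T) := by
  subst hs
  exact congrArg (TM2.stepAux q _) (update_join_inl S T k _)

theorem stepAux_push_inr {Λ : Type} (l : L) (f : Option Symb × τ → Γ l)
    (q : TM2.Stmt (StackAlphabet K Γ) Λ (Option Symb × τ))
    (v : Option Symb × τ) (S : K → List Symb) (T : ∀ l, List (Γ l)) {s : List (Γ l)}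
    (hs : T l = s) :
    TM2.stepAux (.push (.inr l) f q) v (join S T) =
      TM2.stepAux q v (join S (Function.update T l (f v :: s))) := by
  subst hs
  exact congrArg (TM2.stepAux q _) (update_join_inr S T l _)

/-- Reaching a configuration in at most `t` steps. -/
def Reaches {σ : Type} (f : σ → Option σ) (a b : σ) (t : ℕ) : Prop :=
  Nonempty (EvalsToInTime f a (some b) t)

omit [DecidableEq K] in
theorem Reaches.trans {σ : Type} {f : σ → Option σ} {a b c : σ} {t t' : ℕ} (h : Reaches f a b t)
    (h' : Reaches f b c t') : Reaches f a c (t + t') := by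
  obtain ⟨h⟩ := h
  obtain ⟨h'⟩ := h'
  rw [add_comm]
  exact ⟨EvalsToInTime.trans f _ _ _ _ _ h h'⟩

omit [DecidableEq K] in
theorem Reaches.mono {σ : Type} {f : σ → Option σ} {a b : σ} {t t' : ℕ} (h : Reaches f a b t)
    (ht : t ≤ t') : Reaches f a b t' := by
  obtain ⟨h⟩ := h
  exact ⟨⟨h.toEvalsTo, h.steps_le_m.trans ht⟩⟩

omit [DecidableEq K] in
theorem Reaches.single {σ : Type} {f : σ → Option σ} {a b : σ} (h : f a = some b) :
    Reaches f a b 1 :=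
  ⟨⟨⟨1, h⟩, le_rfl⟩⟩

/-- The machine code of a program simulates the program. -/
theorem Runs.reaches {p : Prog K} {S S' : K → List Symb} {t : ℕ} (h : p.Runs S S' t) {Λ : Type}
    (m : Λ → TM2.Stmt (StackAlphabet K Γ) Λ (Option Symb × τ)) (e : p.Lab → Λ) (x : Λ)
    (hm : ∀ l, m (e l) = p.code Γ τ e x l) (v : Option Symb) (w : τ) (T : ∀ l, List (Γ l)) :
    ∃ v', Reaches (TM2.step m) ⟨some (e p.entry), (v, w), join S T⟩
      ⟨some x, (v', w), join S' T⟩ t := by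
  induction h generalizing v x with
  | skip S => exact ⟨v, Reaches.single (step_some _ _ _ _ _ _ (hm ()) rfl)⟩
  | push k a S =>
    exact ⟨v, Reaches.single (step_some _ _ _ _ _ _ (hm ())
      (congrArg (TM2.Cfg.mk _ _) (update_join_inl S T k _)))⟩
  | pop k S =>
    exact ⟨v, Reaches.single (step_some _ _ _ _ _ _ (hm ())
      (congrArg (TM2.Cfg.mk _ _) (update_join_inl S T k _)))⟩
  | @seq p q S S' S'' t t' _ _ ih ih' =>
    obtain ⟨v₁, h₁⟩ := ih (fun l => e (.inl l)) (e (.inr q.entry)) (fun l => hm (.inl l)) v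
    obtain ⟨v₂, h₂⟩ := ih' (fun l => e (.inr l)) x (fun l => hm (.inr l)) v₁
    exact ⟨v₂, h₁.trans h₂⟩
  | @case k ps S S' t _ ih =>
    obtain ⟨v₁, h₁⟩ := ih (fun l => e (some ⟨_, l⟩)) x
      (fun l => (hm (some ⟨(S k).head?, l⟩)).trans (code_case_some k ps e x _ l))
      (S k).head?
    refine ⟨v₁, ?_⟩
    rw [add_comm]
    exact Reaches.trans (Reaches.single (step_some _ _ _ _ _ _
      ((hm none).trans (code_case_none k ps e x)) rfl)) h₁
  | @loop_exit k c p S hc =>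
    refine ⟨(S k).head?, Reaches.single (step_some _ _ _ _ _ _ (hm none) ?_)⟩
    exact congrArg (fun l => TM2.Cfg.mk (some l) _ _) (if_neg (by simp [join, hc]))
  | @loop_step k c p S S' S'' t t' hc _ _ ih ih' =>
    obtain ⟨v₁, h₁⟩ := ih (fun l => e (some l)) (e none) (fun l => hm (some l)) (S k).head?
    obtain ⟨v₂, h₂⟩ := ih' e x hm v₁
    refine ⟨v₂, ?_⟩
    rw [add_comm]
    refine Reaches.trans (Reaches.single (step_some _ _ _ _ _ _ (hm none) ?_)) (h₁.trans h₂)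
    exact congrArg (fun l => TM2.Cfg.mk (some l) _ _) (if_pos (by simp [join, hc]))
  | mono _ ht ih =>
    obtain ⟨v', h⟩ := ih e x hm v
    exact ⟨v', h.mono ht⟩

/-- A statement of a machine as a statement of a composed machine. -/
def liftStmt (K : Type) {Λ Λ' : Type} (e : Λ → Λ') :
    TM2.Stmt Γ Λ τ → TM2.Stmt (StackAlphabet K Γ) Λ' (Option Symb × τ)
  | .push k f q => .push (.inr k) (fun v => f v.2) (liftStmt K e q)
  | .peek k f q => .peek (.inr k) (fun v o => (v.1, f v.2 o)) (liftStmt K e q)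
  | .pop k f q => .pop (.inr k) (fun v o => (v.1, f v.2 o)) (liftStmt K e q)
  | .load f q => .load (fun v => (v.1, f v.2)) (liftStmt K e q)
  | .branch f q r => .branch (fun v => f v.2) (liftStmt K e q) (liftStmt K e r)
  | .goto f => .goto fun v => e (f v.2)
  | .halt => .halt

/-- A configuration of a machine as a configuration of a composed machine. -/
def liftCfg {Λ Λ' : Type} (e : Λ → Λ') (S : K → List Symb) (v : Option Symb)
    (c : TM2.Cfg Γ Λ τ) : TM2.Cfg (StackAlphabet K Γ) Λ' (Option Symb × τ) :=
  ⟨c.l.map e, (v, c.var), join S c.stk⟩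

theorem stepAux_liftStmt {Λ Λ' : Type} (e : Λ → Λ') (S : K → List Symb) (v : Option Symb)
    (q : TM2.Stmt Γ Λ τ) (w : τ) (T : ∀ l, List (Γ l)) :
    TM2.stepAux (liftStmt K e q) (v, w) (join S T) = liftCfg e S v (TM2.stepAux q w T) := by
  induction q generalizing w T with
  | push k f q ih =>
    exact (congrArg (TM2.stepAux (liftStmt K e q) (v, w)) (update_join_inr S T k _)).trans (ih _ _)
  | peek k f q ih => exact ih _ _
  | pop k f q ih =>
    exact (congrArg (TM2.stepAux (liftStmt K e q) (v, f w (T k).head?))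
      (update_join_inr S T k _)).trans (ih _ _)
  | load f q ih => exact ih _ _
  | branch f q r ihq ihr =>
    simp only [liftStmt, TM2.stepAux]
    cases f w
    · exact ihr _ _
    · exact ihq _ _
  | goto f => rfl
  | halt => rfl

/-- A composed machine simulates its second component. -/
theorem Reaches.lift {Λ Λ' : Type} (m : Λ → TM2.Stmt Γ Λ τ)
    (m' : Λ' → TM2.Stmt (StackAlphabet K Γ) Λ' (Option Symb × τ)) (e : Λ → Λ')
    (hm : ∀ l, m' (e l) = liftStmt K e (m l)) (S : K → List Symb) (v : Option Symb)
    {c d : TM2.Cfg Γ Λ τ} {t : ℕ} (h : Reaches (TM2.step m) c d t) :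
    Reaches (TM2.step m') (liftCfg e S v c) (liftCfg e S v d) t := by
  obtain ⟨⟨⟨n, hn⟩, hnt⟩⟩ := h
  refine ⟨⟨⟨n, ?_⟩, hnt⟩⟩
  have hstep : ∀ c, TM2.step m' (liftCfg e S v c) = (TM2.step m c).map (liftCfg e S v) := by
    rintro ⟨_ | l, w, T⟩
    · rfl
    · exact step_some _ _ _ _ _ _ (hm l) (stepAux_liftStmt e S v (m l) w T)
  have hiter : ∀ (n : ℕ) (o : Option (TM2.Cfg Γ Λ τ)),
      (flip bind (TM2.step m'))^[n] (o.map (liftCfg e S v)) =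
        ((flip bind (TM2.step m))^[n] o).map (liftCfg e S v) := by
    intro n
    induction n with
    | zero => intro o; rfl
    | succ n ih =>
      intro o
      rw [Function.iterate_succ_apply, Function.iterate_succ_apply, ← ih]
      congr 1
      cases o with
      | none => rfl
      | some c => exact hstep c
  have := hiter n (some c)
  rw [show (flip bind (TM2.step m))^[n] (some c) = some d from hn] at this
  exact this

end Compile

/-! ### Reductions -/

/-- The machine that runs the program `p`, moves the stack `out` to the input stack of `M`, and
then runs `M`. -/
noncomputable def compose [Fintype K] (p : Prog K) (inp out : K)
    (M : TM2ComputableAux Symb Bool) : TM2ComputableAux Symb Bool :=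
  letI := finite_symb
  letI := Fintype.ofFinite Symb
  letI := finite_lab p
  letI := Fintype.ofFinite p.Lab
  letI := M.tm.ΛFin
  letI := M.tm.σFin
  letI := M.tm.kFin
  { tm :=
      { K := K ⊕ M.tm.K
        k₀ := .inl inp
        k₁ := .inr M.tm.k₁
        Γ := StackAlphabet K M.tm.Γ
        Λ := p.Lab ⊕ Option M.tm.Λ
        main := .inl p.entry
        σ := Option Symb × M.tm.σ
        initialState := (none, M.tm.initialState)
        Γk₀Fin := inferInstanceAs (Fintype Symb)
        m := fun l => match l with
          | .inl l => p.code M.tm.Γ M.tm.σ .inl (.inr none) l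
          | .inr none => .pop (.inl out) (fun v o => (o, v.2)) (.branch (fun v => v.1.isSome)
              (.push (.inr M.tm.k₀) (fun v => M.inputAlphabet.symm (v.1.getD .tally))
                (.goto fun _ => .inr none))
              (.goto fun _ => .inr (some M.tm.main)))
          | .inr (some l) => liftStmt K (fun l => .inr (some l)) (M.tm.m l) }
    inputAlphabet := Equiv.refl Symb
    outputAlphabet := M.outputAlphabet }

omit [DecidableEq K] in
theorem initList_eq (tm : FinTM2) (s : List (tm.Γ tm.k₀)) :
    initList tm s =
      ⟨some tm.main, tm.initialState, Function.update (fun _ => []) tm.k₀ s⟩ := by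
  refine congrArg (TM2.Cfg.mk _ _) (funext fun k => ?_)
  by_cases h : k = tm.k₀
  · subst h; simp
  · simp [h]

omit [DecidableEq K] in
theorem haltList_eq (tm : FinTM2) (s : List (tm.Γ tm.k₁)) :
    haltList tm s = ⟨none, tm.initialState, Function.update (fun _ => []) tm.k₁ s⟩ := by
  refine congrArg (TM2.Cfg.mk _ _) (funext fun k => ?_)
  by_cases h : k = tm.k₁
  · subst h; simp
  · simp [h]

/-- The composed machine runs the program and then hands the resulting word over to `M`. -/
theorem outputsInTime_compose [Fintype K] (p : Prog K) (inp out : K) (hio : out ≠ inp)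
    (M : TM2ComputableAux Symb Bool) (w w' : List Symb) (r : List (M.tm.Γ M.tm.k₁)) (t t' : ℕ)
    (hp : p.Runs (Function.update (fun _ => []) inp w)
      (Function.update (fun _ => []) out w'.reverse) t)
    (hM : Nonempty (TM2OutputsInTime M.tm (w'.map M.inputAlphabet.symm) (some r) t')) :
    Nonempty (TM2OutputsInTime (compose p inp out M).tm w (some r) (2 * t + 1 + t')) := by
  have hlen : w'.length ≤ t := by
    have := hp.length_le out
    simpa [hio] using this
  set m := (compose p inp out M).tm.m with hm
  obtain ⟨v, h₁⟩ := hp.reaches (Γ := M.tm.Γ) (τ := M.tm.σ) m .inl (.inr none) (fun _ => rfl) none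
    M.tm.initialState (fun _ => [])
  have hpop : ∀ (u : List Symb) (v : Option Symb) (T : List (M.tm.Γ M.tm.k₀)),
      TM2.stepAux (m (.inr none)) (v, M.tm.initialState)
          (join (Function.update (fun _ => []) out u) (Function.update (fun _ => []) M.tm.k₀ T)) =
        TM2.stepAux (.branch (fun v => v.1.isSome)
            (.push (.inr M.tm.k₀) (fun v => M.inputAlphabet.symm (v.1.getD .tally))
              (.goto fun _ => .inr none))
            (.goto fun _ => .inr (some M.tm.main)))
          (u.head?, M.tm.initialState) (join (Function.update (fun _ => []) out u.tail)
            (Function.update (fun _ => []) M.tm.k₀ T)) := by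
    intro u v T
    have := stepAux_pop_inl (Γ := M.tm.Γ) (τ := M.tm.σ) out
      (.branch (fun v => v.1.isSome)
            (.push (.inr M.tm.k₀) (fun v => M.inputAlphabet.symm (v.1.getD .tally))
              (.goto fun _ => .inr none))
            (.goto fun _ => .inr (some M.tm.main)) :
        TM2.Stmt _ (p.Lab ⊕ Option M.tm.Λ) _) (v, M.tm.initialState)
      (Function.update (fun _ => []) out u) (Function.update (fun _ => []) M.tm.k₀ T)
      (Function.update_self _ _ _)
    rw [Function.update_idem] at this
    exact this
  have h₂ : ∀ (u : List Symb) (v : Option Symb) (T : List (M.tm.Γ M.tm.k₀)),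
      Reaches (TM2.step m)
        ⟨some (.inr none), (v, M.tm.initialState),
          join (Function.update (fun _ => []) out u) (Function.update (fun _ => []) M.tm.k₀ T)⟩
        (liftCfg (fun l => .inr (some l)) (fun _ => []) none
          (initList M.tm ((u.map M.inputAlphabet.symm).reverse ++ T))) (u.length + 1) := by
    intro u
    induction u with
    | nil =>
      intro v T
      refine Reaches.single (step_some _ _ _ _ _ _ rfl ((hpop [] v T).trans ?_))
      rw [initList_eq]
      change TM2.Cfg.mk _ _ (join (Function.update (fun _ => []) out []) _) = _
      rw [show Function.update (fun _ => []) out [] = fun _ : K => ([] : List Symb) from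
        Function.update_eq_self out _]
      rfl
    | cons a u ih =>
      intro v T
      rw [List.length_cons, add_comm]
      refine Reaches.trans
        (Reaches.single (step_some _ _ _ _ _ _ rfl ((hpop (a :: u) v T).trans ?_)))
        (by simpa using ih (some a) (M.inputAlphabet.symm a :: T))
      refine (stepAux_push_inr M.tm.k₀ (fun v => M.inputAlphabet.symm (v.1.getD .tally))
        (.goto fun _ => .inr none : TM2.Stmt _ (p.Lab ⊕ Option M.tm.Λ) _) _ _ _
        (Function.update_self _ _ _)).trans ?_
      rw [Function.update_idem]
      rfl
  have h₃ := Reaches.lift M.tm.m m (fun l => .inr (some l)) (fun _ => rfl)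
    (fun _ : K => []) none hM
  have h₂' := h₂ w'.reverse v []
  simp only [List.map_reverse, List.reverse_reverse, List.append_nil] at h₂'
  rw [show Function.update (fun _ => []) M.tm.k₀ [] =
    fun k : M.tm.K => ([] : List (M.tm.Γ k)) from Function.update_eq_self _ _] at h₂'
  have := ((h₁.trans h₂').trans h₃).mono (t' := 2 * t + 1 + t') (by simp; omega)
  have e₁ : initList (compose p inp out M).tm w = _ :=
    (initList_eq (compose p inp out M).tm w).trans (congrArg (TM2.Cfg.mk _ _)
      (update_nil_inl inp w))
  have e₂ : haltList (compose p inp out M).tm r = _ :=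
    (haltList_eq (compose p inp out M).tm r).trans (congrArg (TM2.Cfg.mk _ _)
      (update_nil_inr M.tm.k₁ r))
  rw [haltList_eq] at this
  change Reaches (TM2.step m) (initList (compose p inp out M).tm w)
    (haltList (compose p inp out M).tm r) _
  exact Eq.mpr (congrArg₂ (fun a b => Reaches (TM2.step m) a b _) e₁ e₂) this

end Prog

open Prog in
/-- Solving a problem through a reduction that is computed by a stack program. -/
theorem DecidableInTime.of_reduction {K : Type} [DecidableEq K] [Fintype K] (p : Prog K)
    (inp out : K) (hio : out ≠ inp) {α β : Type} {enc : α → List Symb} {enc' : β → List Symb}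
    {S L : Set α} {S' L' : Set β} {T : β → ℝ} (f : α → β) (τ : α → ℕ)
    (hS : ∀ x ∈ S, f x ∈ S') (hL : ∀ x ∈ S, f x ∈ L' ↔ x ∈ L)
    (hp : ∀ x ∈ S, p.Runs (Function.update (fun _ => []) inp (enc x))
      (Function.update (fun _ => []) out (enc' (f x)).reverse) (τ x))
    (h : DecidableInTime enc' S' L' T) :
    DecidableInTime enc S L (fun x => 2 * τ x + 1 + T (f x)) := by
  obtain ⟨M, hΓ, hM⟩ := h
  refine ⟨compose p inp out M, ?_, fun x hx => ?_⟩
  · rintro (k | k)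
    · exact finite_symb
    · exact hΓ k
  · obtain ⟨t, ht, hN⟩ := hM (f x) (hS x hx)
    refine ⟨2 * τ x + 1 + t, by push_cast; linarith, ?_⟩
    have := outputsInTime_compose p inp out hio M _ _ _ _ _ (hp x hx) hN
    have hx' : @decide (f x ∈ L') (Classical.propDecidable _) =
        @decide (x ∈ L) (Classical.propDecidable _) := by simp [hL x hx]
    rw [hx'] at this
    rw [show (enc x).map (compose p inp out M).inputAlphabet.symm = enc x from List.map_id _]
    exact this

end HazardDetection

namespace HazardDetection

/-! ### Laying out formulas of depth four as circuits -/

section Layout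

variable {n : ℕ} {α : Type}

/-- The gates of a list of formulas, one formula after the other, where `c` is the number of the
first gate and `f x c` lists the gates of the formula for `x` if its first gate has the number
`c`. -/
def layList (f : α → ℕ → List (Gate n)) : List α → ℕ → List (Gate n)
  | [], _ => []
  | x :: l, c => f x c ++ layList f l (c + (f x c).length)

/-- The numbers of the output gates of a list of formulas laid out by `layList`, in descending
order. -/
def layOuts (f : α → ℕ → List (Gate n)) : List α → ℕ → List ℕ
  | [], _ => []
  | x :: l, c => layOuts f l (c + (f x c).length) ++ [c + (f x c).length - 1]

/-- The gates of a formula that combines a list of formulas by the gate `op`. The output gate comes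
last. -/
def layNode (op : List ℕ → Gate n) (f : α → ℕ → List (Gate n)) (l : List α) (c : ℕ) :
    List (Gate n) :=
  layList f l c ++ [op (layOuts f l c)]

theorem layList_append (f : α → ℕ → List (Gate n)) (l l' : List α) (c : ℕ) :
    layList f (l ++ l') c = layList f l c ++ layList f l' (c + (layList f l c).length) := by
  induction l generalizing c with
  | nil => simp [layList]
  | cons x l ih => simp [layList, ih, add_assoc]

theorem layOuts_append (f : α → ℕ → List (Gate n)) (l l' : List α) (c : ℕ) :
    layOuts f (l ++ l') c = layOuts f l' (c + (layList f l c).length) ++ layOuts f l c := by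
  induction l generalizing c with
  | nil => simp [layList, layOuts]
  | cons x l ih => simp [layList, layOuts, ih, add_assoc]

/-- The gates `G`, numbered from `c` on, form a tree with the last gate as its root: every gate but
the last one is wired to exactly one gate, which is a later one. -/
structure IsTree (G : List (Gate n)) (c : ℕ) : Prop where
  ne_nil : G ≠ []
  perm : List.Perm (G.flatMap Gate.inputs ++ [c + G.length - 1]) (List.range' c G.length)
  acyclic : ∀ i g, G[i]? = some g → ∀ j ∈ g.inputs, j < c + i
  inputs_ne : ∀ g ∈ G, g ≠ Gate.and [] ∧ g ≠ Gate.or []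

theorem perm_layList {f : α → ℕ → List (Gate n)} {l : List α} (h : ∀ x ∈ l, ∀ c, IsTree (f x c) c)
    (c : ℕ) : List.Perm ((layList f l c).flatMap Gate.inputs ++ layOuts f l c)
      (List.range' c (layList f l c).length) := by
  induction l generalizing c with
  | nil => simp [layList, layOuts]
  | cons x l ih =>
    have h₁ := (h x (by simp) c).perm
    have h₂ := ih (fun y hy => h y (by simp [hy])) (c + (f x c).length)
    simp only [layList, layOuts, List.flatMap_append, List.length_append]
    rw [← List.range'_append_1]
    refine List.Perm.trans ?_ (h₁.append h₂)
    simp only [List.append_assoc]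
    refine List.Perm.append_left _ ?_
    rw [← List.append_assoc]
    exact List.perm_append_comm

theorem acyclic_layList {f : α → ℕ → List (Gate n)} {l : List α}
    (h : ∀ x ∈ l, ∀ c, IsTree (f x c) c) (c : ℕ) (i : ℕ) (g : Gate n)
    (hg : (layList f l c)[i]? = some g) : ∀ j ∈ g.inputs, j < c + i := by
  induction l generalizing c i with
  | nil => simp [layList] at hg
  | cons x l ih =>
    rw [layList, List.getElem?_append] at hg
    split_ifs at hg with hi
    · exact (h x (by simp) c).acyclic i g hg
    · intro j hj
      have := ih (fun y hy => h y (by simp [hy])) _ _ hg j hj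
      omega

theorem inputs_ne_layList {f : α → ℕ → List (Gate n)} {l : List α}
    (h : ∀ x ∈ l, ∀ c, IsTree (f x c) c) (c : ℕ) (g : Gate n) (hg : g ∈ layList f l c) :
    g ≠ Gate.and [] ∧ g ≠ Gate.or [] := by
  induction l generalizing c with
  | nil => simp [layList] at hg
  | cons x l ih =>
    rw [layList, List.mem_append] at hg
    rcases hg with hg | hg
    · exact (h x (by simp) c).inputs_ne g hg
    · exact ih (fun y hy => h y (by simp [hy])) _ hg

theorem layOuts_ne_nil (f : α → ℕ → List (Gate n)) {l : List α} (hl : l ≠ []) (c : ℕ) :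
    layOuts f l c ≠ [] := by
  cases l with
  | nil => exact absurd rfl hl
  | cons x l => simp [layOuts]

theorem IsTree.layNode {op : List ℕ → Gate n} (hop : op = .and ∨ op = .or)
    {f : α → ℕ → List (Gate n)} {l : List α} (hl : l ≠ []) (h : ∀ x ∈ l, ∀ c, IsTree (f x c) c)
    (c : ℕ) : IsTree (layNode op f l c) c := by
  have hin : ∀ js, (op js).inputs = js := by
    rcases hop with rfl | rfl <;> intro js <;> rfl
  refine ⟨by simp [HazardDetection.layNode], ?_, ?_, ?_⟩
  · simp only [HazardDetection.layNode, List.flatMap_append, List.flatMap_cons, hin,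
      List.flatMap_nil, List.append_nil, List.length_append, List.length_singleton]
    rw [← List.range'_append_1]
    exact (perm_layList h c).append (by simp [List.range'])
  · intro i g hg
    rw [HazardDetection.layNode, List.getElem?_append] at hg
    split_ifs at hg with hi
    · exact acyclic_layList h c i g hg
    · obtain rfl : i = (layList f l c).length := by
        have := (List.getElem?_eq_some_iff.1 hg).1
        simp at this
        omega
      simp only [Nat.sub_self, List.getElem?_cons_zero, Option.some.injEq] at hg
      subst hg
      intro j hj
      rw [hin] at hj
      have := (perm_layList h c).mem_iff.1 (List.mem_append_right _ hj)
      exact (List.mem_range'_1.1 this).2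
  · intro g hg
    rw [HazardDetection.layNode, List.mem_append, List.mem_singleton] at hg
    rcases hg with hg | rfl
    · exact inputs_ne_layList h c g hg
    · have := layOuts_ne_nil f hl c
      rcases hop with rfl | rfl <;> simpa using this

/-- The list of gate values (or depths) that arises by evaluating the gates `G`, numbered from
`prev.length` on, with the rule `φ`. -/
def scan {A : Type} (φ : Gate n → List A → A) (prev : List A) (G : List (Gate n)) : List A :=
  G.foldl (fun prev g => prev ++ [φ g prev]) prev

theorem scan_append {A : Type} (φ : Gate n → List A → A) (prev : List A) (G H : List (Gate n)) :
    scan φ prev (G ++ H) = scan φ (scan φ prev G) H := by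
  simp [scan]

/-- Under the rule `φ`, the last one of the gates `G`, numbered from `c` on, gets the value `a`, and
all gates get values as required by `Q`. -/
def ScansTo {A : Type} (φ : Gate n → List A → A) (Q : Gate n → A → Prop) (G : List (Gate n)) (c : ℕ)
    (a : A) : Prop :=
  ∀ prev, prev.length = c → ∃ vs, scan φ prev G = prev ++ vs ∧ vs.getLast? = some a ∧
    List.Forall₂ Q G vs

theorem scan_layList {A : Type} {φ : Gate n → List A → A} {Q : Gate n → A → Prop}
    {f : α → ℕ → List (Gate n)} {a : α → A} (d : A) {l : List α}
    (h : ∀ x ∈ l, ∀ c, ScansTo φ Q (f x c) c (a x)) (prev : List A) :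
    ∃ vs, scan φ prev (layList f l prev.length) = prev ++ vs ∧
      (layOuts f l prev.length).map (fun j => (prev ++ vs).getD j d) = (l.map a).reverse ∧
      List.Forall₂ Q (layList f l prev.length) vs := by
  induction l generalizing prev with
  | nil => exact ⟨[], by simp [layList, layOuts, scan]⟩
  | cons x l ih =>
    obtain ⟨vs, h₁, h₂, h₃⟩ := h x (by simp) _ prev rfl
    obtain ⟨vs', h₁', h₂', h₃'⟩ := ih (fun y hy => h y (by simp [hy])) (prev ++ vs)
    have hlen := h₃.length_eq
    rw [List.length_append, ← hlen] at h₁' h₂' h₃'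
    refine ⟨vs ++ vs', ?_, ?_, ?_⟩
    · rw [layList, scan_append, h₁, h₁', List.append_assoc]
    · rw [layOuts, List.map_append, ← List.append_assoc, h₂', List.map_cons, List.map_nil,
        List.map_cons, List.reverse_cons]
      congr 1
      obtain ⟨us, rfl⟩ : ∃ us, vs = us ++ [a x] := by
        rw [List.getLast?_eq_some_iff] at h₂
        exact h₂
      simp only [hlen, List.length_append, List.length_singleton]
      congr 1
      rw [List.getD_eq_getElem?_getD]
      simp
    · exact List.rel_append h₃ h₃'

theorem ScansTo.layNode {A : Type} {φ : Gate n → List A → A} {Q : Gate n → A → Prop}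
    {f : α → ℕ → List (Gate n)} {a : α → A} (d : A) {op : List ℕ → Gate n} {comb : List A → A}
    (hop : ∀ js prev, φ (op js) prev = comb (js.map fun j => prev.getD j d)) {l : List α}
    (h : ∀ x ∈ l, ∀ c, ScansTo φ Q (f x c) c (a x))
    (hQ : ∀ js, Q (op js) (comb (l.map a).reverse)) (c : ℕ) :
    ScansTo φ Q (layNode op f l c) c (comb (l.map a).reverse) := by
  rintro prev rfl
  obtain ⟨vs, h₁, h₂, h₃⟩ := scan_layList d h prev
  refine ⟨vs ++ [comb (l.map a).reverse], ?_, by simp, ?_⟩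
  · rw [HazardDetection.layNode, scan_append, h₁]
    simp only [scan, List.foldl_cons, List.foldl_nil, hop, h₂, List.append_assoc]
  · exact List.rel_append h₃ (.cons (hQ _) .nil)

end Layout

/-- A formula with the gates `∨∧∨∧` as a nested list of literals. -/
abbrev Formula4 (n : ℕ) := List (List (List (List (Literal n))))

namespace Formula4

variable {n : ℕ}

/-- The single gate for a literal. -/
def layLit (l : Literal n) (_ : ℕ) : List (Gate n) := [.lit l.1 l.2]

/-- The gates for a conjunction of literals. -/
def layTerm : List (Literal n) → ℕ → List (Gate n) := layNode .and layLit

/-- The gates for a formula in disjunctive normal form. -/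
def layDNF : List (List (Literal n)) → ℕ → List (Gate n) := layNode .or layTerm

/-- The gates for a conjunction of formulas in disjunctive normal form. -/
def layConj : List (List (List (Literal n))) → ℕ → List (Gate n) := layNode .and layDNF

/-- The gates for a formula. -/
def lay : Formula4 n → ℕ → List (Gate n) := layNode .or layConj

/-- No conjunction or disjunction in the formula is empty. -/
def Proper (F : Formula4 n) : Prop :=
  F ≠ [] ∧ ∀ D ∈ F, D ≠ [] ∧ ∀ B ∈ D, B ≠ [] ∧ ∀ t ∈ B, t ≠ []

theorem isTree_layLit (l : Literal n) (c : ℕ) : IsTree (layLit l c) c := by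
  refine ⟨by simp [layLit], by simp [layLit, Gate.inputs], ?_, by simp [layLit]⟩
  intro i g hg j hj
  have := List.mem_of_getElem? hg
  simp only [layLit, List.mem_singleton] at this
  subst this
  simp [Gate.inputs] at hj

variable {F : Formula4 n}

theorem isTree_lay (hF : F.Proper) (c : ℕ) : IsTree (F.lay c) c :=
  .layNode (.inr rfl) hF.1 (fun D hD => .layNode (.inl rfl) (hF.2 D hD).1 (fun B hB =>
    .layNode (.inr rfl) ((hF.2 D hD).2 B hB).1 (fun t ht =>
      .layNode (.inl rfl) (((hF.2 D hD).2 B hB).2 t ht) (fun l _ => isTree_layLit l)))) c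

theorem count_inputs_lay (hF : F.Proper) (j : ℕ) (hj : j + 1 < (F.lay 0).length) :
    (F.lay 0).countP (fun g => decide (j ∈ g.inputs)) = 1 := by
  have h := (isTree_lay hF 0).perm
  have hn : ((F.lay 0).flatMap Gate.inputs).Nodup :=
    (List.nodup_append.1 (h.nodup_iff.2 List.nodup_range')).1
  have hc := h.count_eq j
  rw [List.count_append, List.count_singleton, List.count_eq_one_of_mem List.nodup_range'
    (List.mem_range'_1.2 ⟨Nat.zero_le _, by omega⟩), if_neg (by simp; omega), add_zero] at hc
  rw [← hc]
  clear hc h hj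
  generalize F.lay 0 = G at hn ⊢
  induction G with
  | nil => simp
  | cons g G ih =>
    rw [List.flatMap_cons] at hn ⊢
    rw [List.countP_cons, List.count_append, ih (List.nodup_append.1 hn).2.1, add_comm]
    congr 1
    rw [List.Nodup.count (List.nodup_append.1 hn).1]
    simp

/-- The circuit for a formula. -/
def circuit (F : Formula4 n) (hF : F.Proper) : Circuit n where
  gates := F.lay 0
  gates_ne := (isTree_lay hF 0).ne_nil
  acyclic i h j hj := by
    simpa using (isTree_lay hF 0).acyclic i _ (List.getElem?_eq_getElem h) j hj
  inputs_nodup g hg := by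
    have h := (isTree_lay hF 0).perm
    have hn : ((F.lay 0).flatMap Gate.inputs).Nodup :=
      (List.nodup_append.1 (h.nodup_iff.2 List.nodup_range')).1
    exact (List.nodup_flatMap.1 hn).1 g hg
  inputs_ne := (isTree_lay hF 0).inputs_ne
  unique_sink j hj := by
    have h := count_inputs_lay hF j hj
    obtain ⟨g, hg, hjg⟩ := List.countP_pos_iff.1 (h ▸ Nat.one_pos)
    exact ⟨g, hg, by simpa using hjg⟩

/-- The gates of an `∨∧∨∧` formula have the depths that fit to their types. -/
def DepthFits (g : Gate n) (d : ℕ) : Prop :=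
  match g with
  | .lit _ _ => True
  | .and _ => d = 3 ∨ d = 1
  | .or _ => d = 4 ∨ d = 2

theorem scansTo_depth_layNode {α : Type} {f : α → ℕ → List (Gate n)} {l : List α} (hl : l ≠ [])
    {d : ℕ} {op : List ℕ → Gate n} (hop : op = .and ∨ op = .or)
    (h : ∀ x ∈ l, ∀ c, ScansTo (fun g prev => g.depth prev) DepthFits (f x c) c d)
    (hQ : ∀ js, DepthFits (op js) (d + 1)) (c : ℕ) :
    ScansTo (fun g prev => g.depth prev) DepthFits (layNode op f l c) c (d + 1) := by
  have hmax : ∀ m, m ≠ 0 → (List.replicate m d).foldr max 0 = d := by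
    intro m hm
    induction m with
    | zero => exact absurd rfl hm
    | succ m ih =>
      rw [List.replicate_succ, List.foldr_cons]
      rcases eq_or_ne m 0 with rfl | hm
      · simp
      · rw [ih hm, max_self]
  have hc : (l.map fun _ => d).reverse.foldr max 0 = d := by
    rw [List.map_const', List.reverse_replicate]
    exact hmax _ (by simpa using hl)
  have := ScansTo.layNode (φ := fun g prev => g.depth prev) (Q := DepthFits) (f := f)
    (a := fun _ => d) 0 (op := op) (comb := fun l => l.foldr max 0 + 1)
    (by rcases hop with rfl | rfl <;> intro js prev <;> rfl) (l := l) h (by simpa only [hc]) c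
  simpa only [hc] using this

theorem scansTo_depth_lay (hF : F.Proper) (c : ℕ) :
    ScansTo (fun g prev => g.depth prev) DepthFits (F.lay c) c 4 := by
  refine scansTo_depth_layNode hF.1 (.inr rfl) (fun D hD => scansTo_depth_layNode (hF.2 D hD).1
    (.inl rfl) (fun B hB => scansTo_depth_layNode ((hF.2 D hD).2 B hB).1 (.inr rfl)
      (fun t ht => scansTo_depth_layNode (((hF.2 D hD).2 B hB).2 t ht) (.inl rfl) (d := 0)
        (fun l _ c prev _ => ?_) ?_) ?_) ?_) ?_ c
  · exact ⟨[0], rfl, rfl, .cons trivial .nil⟩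
  · exact fun _ => .inr rfl
  · exact fun _ => .inr rfl
  · exact fun _ => .inl rfl
  · exact fun _ => .inl rfl

theorem isOrAndOrAnd_circuit (hF : F.Proper) : (F.circuit hF).IsOrAndOrAnd := by
  obtain ⟨vs, h₁, h₂, h₃⟩ := scansTo_depth_lay hF 0 [] rfl
  have hd : (F.circuit hF).depths = vs := h₁
  refine ⟨count_inputs_lay hF, ?_, fun i h => ?_⟩
  · rw [Circuit.depth, hd, List.getLastD_eq_getLast?, h₂]
    rfl
  · have hi : i < vs.length := h₃.length_eq ▸ h
    have := (List.forall₂_iff_get.1 h₃).2 i h hi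
    rw [hd, List.getD_eq_getElem _ _ hi]
    simp only [List.get_eq_getElem] at this
    change DepthFits ((F.lay 0)[i]'h) vs[i] at this
    exact this

/-- The value of a literal. -/
def litVal (x : Fin n → Ternary) (l : Literal n) : Ternary :=
  if l.2 then x l.1 else (x l.1).not

/-- The value of a term. -/
def termVal (x : Fin n → Ternary) (t : List (Literal n)) : Ternary :=
  .bigAnd (t.map (litVal x)).reverse

/-- The value of a formula in disjunctive normal form. -/
def dnfVal (x : Fin n → Ternary) (B : List (List (Literal n))) : Ternary :=
  .bigOr (B.map (termVal x)).reverse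

/-- The value of a conjunction of formulas in disjunctive normal form. -/
def conjVal (x : Fin n → Ternary) (D : List (List (List (Literal n)))) : Ternary :=
  .bigAnd (D.map (dnfVal x)).reverse

/-- The value of a formula. -/
def val (x : Fin n → Ternary) (F : Formula4 n) : Ternary :=
  .bigOr (F.map (conjVal x)).reverse

theorem eval_circuit (hF : F.Proper) (x : Fin n → Ternary) :
    (F.circuit hF).eval x = F.val x := by
  have h : ScansTo (fun g prev => g.value x prev) (fun _ _ => True) (F.lay 0) 0 (F.val x) := by
    refine ScansTo.layNode (comb := .bigOr) (a := conjVal x) .u (fun _ _ => rfl) (fun D _ =>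
      ScansTo.layNode (comb := .bigAnd) (a := dnfVal x) .u (fun _ _ => rfl) (fun B _ =>
      ScansTo.layNode (comb := .bigOr) (a := termVal x) .u (fun _ _ => rfl) (fun t _ =>
      ScansTo.layNode (comb := .bigAnd) (a := litVal x) .u (fun _ _ => rfl) (fun l _ c prev _ => ?_)
      ?_) ?_) ?_) ?_ 0
    · exact ⟨[litVal x l], rfl, rfl, .cons trivial .nil⟩
    all_goals exact fun _ => trivial
  obtain ⟨vs, h₁, h₂, -⟩ := h [] rfl
  have hv : (F.circuit hF).values x = vs := h₁
  rw [Circuit.eval, hv, List.getLastD_eq_getLast?, h₂]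
  rfl

end Formula4

namespace Ternary

theorem bigAnd_eq_one {l : List Ternary} : bigAnd l = one ↔ ∀ a ∈ l, a = one := by
  induction l with
  | nil => simp [bigAnd]
  | cons a l ih =>
    rw [List.forall_mem_cons, ← ih]
    change and a (bigAnd l) = one ↔ _
    cases a <;> cases bigAnd l <;> simp [and]

theorem bigAnd_eq_zero {l : List Ternary} : bigAnd l = zero ↔ ∃ a ∈ l, a = zero := by
  induction l with
  | nil => simp [bigAnd]
  | cons a l ih =>
    rw [List.exists_mem_cons_iff, ← ih]
    change and a (bigAnd l) = zero ↔ _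
    cases a <;> cases bigAnd l <;> simp [and]

theorem bigOr_eq_one {l : List Ternary} : bigOr l = one ↔ ∃ a ∈ l, a = one := by
  induction l with
  | nil => simp [bigOr]
  | cons a l ih =>
    rw [List.exists_mem_cons_iff, ← ih]
    change or a (bigOr l) = one ↔ _
    cases a <;> cases bigOr l <;> simp [or]

theorem bigOr_eq_zero {l : List Ternary} : bigOr l = zero ↔ ∀ a ∈ l, a = zero := by
  induction l with
  | nil => simp [bigOr]
  | cons a l ih =>
    rw [List.forall_mem_cons, ← ih]
    change or a (bigOr l) = zero ↔ _
    cases a <;> cases bigOr l <;> simp [or]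

end Ternary

namespace Formula4

variable {n : ℕ} {F : Formula4 n} {x : Fin n → Ternary}

theorem val_eq_one : F.val x = .one ↔ ∃ D ∈ F, ∀ B ∈ D, ∃ t ∈ B, ∀ l ∈ t, litVal x l = .one := by
  simp only [val, conjVal, dnfVal, termVal, Ternary.bigAnd_eq_one, Ternary.bigOr_eq_one,
    List.mem_reverse, List.mem_map, exists_exists_and_eq_and, forall_exists_index, and_imp,
    forall_apply_eq_imp_iff₂]

theorem val_eq_zero :
    F.val x = .zero ↔ ∀ D ∈ F, ∃ B ∈ D, ∀ t ∈ B, ∃ l ∈ t, litVal x l = .zero := by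
  simp only [val, conjVal, dnfVal, termVal, Ternary.bigAnd_eq_zero, Ternary.bigOr_eq_zero,
    List.mem_reverse, List.mem_map, exists_exists_and_eq_and, forall_exists_index, and_imp,
    forall_apply_eq_imp_iff₂]

end Formula4

end HazardDetection

namespace HazardDetection

/-! ### Ternary words and block codes -/

instance : Fintype Ternary := ⟨{.zero, .one, .u}, fun a => by cases a <;> simp⟩

section Words

variable {q : ℕ}

/-- The number of ones in a ternary word. -/
def ones (x : Fin q → Ternary) : ℕ := (Finset.univ.filter fun o => x o = .one).card

/-- The number of zeros in a ternary word. -/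
def zeros (x : Fin q → Ternary) : ℕ := (Finset.univ.filter fun o => x o = .zero).card

/-- `x` agrees with `a` wherever `a` is stable. -/
def Refines (x a : Fin q → Ternary) : Prop := ∀ o, a o ≠ .u → x o = a o

theorem Refines.ones_le {x a : Fin q → Ternary} (h : Refines x a) : ones a ≤ ones x := by
  refine Finset.card_le_card fun o ho => ?_
  simp only [Finset.mem_filter, Finset.mem_univ, true_and] at ho ⊢
  rw [h o (by simp [ho]), ho]

theorem Refines.zeros_le {x a : Fin q → Ternary} (h : Refines x a) : zeros a ≤ zeros x := by
  refine Finset.card_le_card fun o ho => ?_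
  simp only [Finset.mem_filter, Finset.mem_univ, true_and] at ho ⊢
  rw [h o (by simp [ho]), ho]

/-- The words with given numbers of ones and zeros form an antichain. -/
theorem Refines.eq_of_le {x a : Fin q → Ternary} (h : Refines x a) (h₁ : ones x ≤ ones a)
    (h₀ : zeros x ≤ zeros a) : x = a := by
  have e₁ := Finset.eq_of_subset_of_card_le (s := Finset.univ.filter fun o => a o = .one)
    (t := Finset.univ.filter fun o => x o = .one) (fun o ho => by
      simp only [Finset.mem_filter, Finset.mem_univ, true_and] at ho ⊢
      rw [h o (by simp [ho]), ho]) h₁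
  have e₀ := Finset.eq_of_subset_of_card_le (s := Finset.univ.filter fun o => a o = .zero)
    (t := Finset.univ.filter fun o => x o = .zero) (fun o ho => by
      simp only [Finset.mem_filter, Finset.mem_univ, true_and] at ho ⊢
      rw [h o (by simp [ho]), ho]) h₀
  funext o
  have h₁ := Finset.ext_iff.1 e₁ o
  have h₀ := Finset.ext_iff.1 e₀ o
  simp only [Finset.mem_filter, Finset.mem_univ, true_and] at h₁ h₀
  cases ha : a o <;> cases hx : x o <;> simp_all

/-- Making some stable positions unstable, one can lower the numbers of ones and zeros at will. -/
theorem exists_refines {x : Fin q → Ternary} {i j : ℕ} (hi : i ≤ ones x) (hj : j ≤ zeros x) :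
    ∃ a, ones a = i ∧ zeros a = j ∧ Refines x a := by
  obtain ⟨A, hA, rfl⟩ := Finset.exists_subset_card_eq hi
  obtain ⟨B, hB, rfl⟩ := Finset.exists_subset_card_eq hj
  have hA' : ∀ o ∈ A, x o = .one := fun o ho => (Finset.mem_filter.1 (hA ho)).2
  have hB' : ∀ o ∈ B, x o = .zero := fun o ho => (Finset.mem_filter.1 (hB ho)).2
  have hAB : ∀ o ∈ A, o ∉ B := fun o ho ho' => by
    have := hA' o ho
    rw [hB' o ho'] at this
    cases this
  refine ⟨fun o => if o ∈ A then .one else if o ∈ B then .zero else .u, ?_, ?_, ?_⟩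
  · refine congrArg Finset.card (Finset.ext fun o => ?_)
    by_cases h₁ : o ∈ A <;> by_cases h₂ : o ∈ B <;> simp [h₁, h₂]
  · refine congrArg Finset.card (Finset.ext fun o => ?_)
    by_cases h₁ : o ∈ A <;> by_cases h₂ : o ∈ B <;> simp [h₁, h₂]
    exact hAB o h₁ h₂
  · intro o ho
    by_cases h₁ : o ∈ A
    · simp [h₁, hA' o h₁]
    · by_cases h₂ : o ∈ B
      · simp [h₁, h₂, hB' o h₂]
      · simp [h₁, h₂] at ho

theorem ones_add_zeros (b : Fin q → Bool) :
    ones (fun o => Ternary.ofBool (b o)) + zeros (fun o => Ternary.ofBool (b o)) = q := by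
  have h := Finset.card_filter_add_card_filter_not (s := (Finset.univ : Finset (Fin q)))
    (fun o => b o = true)
  rw [Finset.card_univ, Fintype.card_fin] at h
  refine Eq.trans ?_ h
  rw [ones, zeros]
  congr 2 <;> ext o <;> rw [Finset.mem_filter, Finset.mem_filter] <;> cases hb : b o <;>
    simp [Ternary.ofBool]

/-- The ternary words with `i` ones and `j` zeros. -/
noncomputable def words (q i j : ℕ) : List (Fin q → Ternary) :=
  (Finset.univ.filter fun a => ones a = i ∧ zeros a = j).toList

theorem mem_words {i j : ℕ} {a : Fin q → Ternary} :
    a ∈ words q i j ↔ ones a = i ∧ zeros a = j := by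
  simp [words]

/-- A word refines some word in the list. -/
def Covers (x : Fin q → Ternary) (A : List (Fin q → Ternary)) : Prop := ∃ a ∈ A, Refines x a

theorem covers_words {i j : ℕ} {x : Fin q → Ternary} :
    Covers x (words q i j) ↔ i ≤ ones x ∧ j ≤ zeros x := by
  constructor
  · rintro ⟨a, ha, h⟩
    obtain ⟨rfl, rfl⟩ := mem_words.1 ha
    exact ⟨h.ones_le, h.zeros_le⟩
  · rintro ⟨hi, hj⟩
    obtain ⟨a, h₁, h₀, h⟩ := exists_refines hi hj
    exact ⟨a, mem_words.2 ⟨h₁, h₀⟩, h⟩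

end Words

/-- A code for `P` bits by ternary words of length `q`. The code words are the words with given
numbers of ones and zeros, that is, the prime implicants of the Boolean function that demands at
least these numbers of ones and zeros. -/
structure BlockCode (q P : ℕ) where
  /-- the number of ones in a code word -/
  numOnes : ℕ
  /-- the number of zeros in a code word -/
  numZeros : ℕ
  /-- the term for a code word is not empty -/
  pos : 0 < numOnes + numZeros
  /-- a code word has an unstable position -/
  lt : numOnes + numZeros < q
  /-- the decoding function -/
  dec : (Fin q → Ternary) → Fin P → Bool
  /-- every block of bits is encoded by some code word -/
  surj : ∀ y, ∃ a ∈ words q numOnes numZeros, dec a = y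

namespace BlockCode

variable {q P : ℕ} (c : BlockCode q P)

/-- The code words. -/
noncomputable def full : List (Fin q → Ternary) := words q c.numOnes c.numZeros

/-- The words with one more stable position than a code word. -/
noncomputable def nonprime : List (Fin q → Ternary) :=
  words q (c.numOnes + 1) c.numZeros ++ words q c.numOnes (c.numZeros + 1)

/-- The code words that make a literal false. -/
noncomputable def falsify (o : Fin P) (s : Bool) : List (Fin q → Ternary) :=
  c.full.filter fun a => c.dec a o != s

variable {c} {x : Fin q → Ternary}

theorem covers_full : Covers x c.full ↔ c.numOnes ≤ ones x ∧ c.numZeros ≤ zeros x := covers_words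

theorem covers_nonprime : Covers x c.nonprime ↔
    (c.numOnes + 1 ≤ ones x ∧ c.numZeros ≤ zeros x) ∨
      (c.numOnes ≤ ones x ∧ c.numZeros + 1 ≤ zeros x) := by
  rw [← covers_words, ← covers_words]
  simp only [Covers, nonprime, List.mem_append, or_and_right, exists_or]

theorem mem_full_of_not_covers (h : Covers x c.full) (h' : ¬ Covers x c.nonprime) :
    x ∈ c.full := by
  rw [covers_full] at h
  rw [covers_nonprime] at h'
  refine mem_words.2 ?_
  omega

theorem not_covers_nonprime (h : x ∈ c.full) : ¬ Covers x c.nonprime := by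
  have := mem_words.1 h
  rw [covers_nonprime]
  omega

/-- A Boolean word that refines a code word has more stable positions than that code word. -/
theorem covers_nonprime_of_full {b : Fin q → Bool}
    (h : Covers (fun o => Ternary.ofBool (b o)) c.full) :
    Covers (fun o => Ternary.ofBool (b o)) c.nonprime := by
  have := ones_add_zeros b
  have := c.lt
  rw [covers_full] at h
  rw [covers_nonprime]
  omega

/-- Since the code words form an antichain, a code word `x` refines no other code word. -/
theorem covers_falsify (h : x ∈ c.full) {o : Fin P} {s : Bool} :
    Covers x (c.falsify o s) ↔ c.dec x o ≠ s := by
  constructor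
  · rintro ⟨a, ha, hxa⟩
    obtain ⟨ha, hs⟩ := List.mem_filter.1 ha
    have h₁ := mem_words.1 h
    have h₂ := mem_words.1 ha
    obtain rfl := hxa.eq_of_le (by omega) (by omega)
    simpa using hs
  · intro hs
    exact ⟨x, List.mem_filter.2 ⟨h, by simpa using hs⟩, fun _ _ => rfl⟩

/-- A word all of whose resolutions satisfy the function of the block satisfies it by itself. -/
theorem covers_full_of_resolutions (h : ∀ b : Fin q → Bool, IsResolution x b →
    Covers (fun o => Ternary.ofBool (b o)) c.full) : Covers x c.full := by
  rw [covers_full]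
  constructor
  -- The resolution with as few ones as possible, and below the one with as few zeros as possible.
  · have := covers_full.1 (h (fun o => decide (x o = .one)) (fun o ho => by
      cases hx : x o <;> simp_all [Ternary.ofBool]))
    refine this.1.trans (Finset.card_le_card fun o ho => ?_)
    rw [Finset.mem_filter] at ho ⊢
    cases hx : x o <;> simp_all [Ternary.ofBool]
  · have := covers_full.1 (h (fun o => decide (x o ≠ .zero)) (fun o ho => by
      cases hx : x o <;> simp_all [Ternary.ofBool]))
    refine this.2.trans (Finset.card_le_card fun o ho => ?_)
    rw [Finset.mem_filter] at ho ⊢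
    cases hx : x o <;> simp_all [Ternary.ofBool]

end BlockCode

/-! ### The reduction from CNF satisfiability to hazard detection -/

/-- The literals of the term that is satisfied by the refinements of a word. -/
def wordLits {q : ℕ} (a : Fin q → Ternary) : List (Fin q × Bool) :=
  (List.finRange q).filterMap fun o =>
    match a o with
    | .zero => some (o, false)
    | .one => some (o, true)
    | .u => none

theorem mem_wordLits {q : ℕ} {a : Fin q → Ternary} {o : Fin q} {s : Bool} :
    (o, s) ∈ wordLits a ↔ a o = Ternary.ofBool s := by
  simp only [wordLits, List.mem_filterMap, List.mem_finRange, true_and]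
  constructor
  · rintro ⟨o', h⟩
    cases ha : a o' <;> simp only [ha, Option.some.injEq, Prod.mk.injEq, reduceCtorEq] at h
    · obtain ⟨rfl, rfl⟩ := h
      exact ha
    · obtain ⟨rfl, rfl⟩ := h
      exact ha
  · intro h
    refine ⟨o, ?_⟩
    cases s <;> simp [h, Ternary.ofBool]

theorem wordLits_ne_nil {q : ℕ} {a : Fin q → Ternary} (h : 0 < ones a + zeros a) :
    wordLits a ≠ [] := by
  have : 0 < ones a ∨ 0 < zeros a := by omega
  rcases this with h | h <;> obtain ⟨o, ho⟩ := Finset.card_pos.1 h <;>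
    simp only [Finset.mem_filter, Finset.mem_univ, true_and] at ho
  · exact List.ne_nil_of_mem (mem_wordLits (s := true).2 ho)
  · exact List.ne_nil_of_mem (mem_wordLits (s := false).2 ho)

theorem exists_mem_map_iff {A B : Type*} {f : A → B} {l : List A} {p : B → Prop} :
    (∃ b ∈ l.map f, p b) ↔ ∃ a ∈ l, p (f a) := by
  simp only [List.mem_map, exists_exists_and_eq_and]

section Blocks

variable {q N : ℕ}

/-- The literal at the position `l.1` of the block `b`. -/
def blockLit (b : Fin N) (l : Fin q × Bool) : Literal (N * q) := (finProdFinEquiv (b, l.1), l.2)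

/-- The formula in disjunctive normal form that is satisfied if the block `b` refines a word of the
list. -/
def blockDNF (b : Fin N) (A : List (Fin q → Ternary)) : List (List (Literal (N * q))) :=
  A.map fun a => (wordLits a).map (blockLit b)

/-- The word in the block `b` of an input. -/
def block {A : Type} (x : Fin (N * q) → A) (b : Fin N) (o : Fin q) : A := x (finProdFinEquiv (b, o))

theorem forall_litVal_eq_one {x : Fin (N * q) → Ternary} {b : Fin N} {a : Fin q → Ternary} :
    (∀ l ∈ (wordLits a).map (blockLit b), Formula4.litVal x l = .one) ↔ Refines (block x b) a := by
  simp only [List.forall_mem_map, Prod.forall, mem_wordLits, blockLit, Formula4.litVal]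
  constructor
  · intro h o ho
    have h' := h o
    simp only [block]
    cases ha : a o
    · have := h' false ha
      cases hx : x (finProdFinEquiv (b, o)) <;> simp_all [Ternary.not]
    · simpa using h' true ha
    · exact absurd ha ho
  · intro h o s ha
    have := h o (by cases s <;> simp [ha, Ternary.ofBool])
    simp only [block] at this
    rw [this, ha]
    cases s <;> rfl

theorem exists_litVal_eq_zero {x : Fin (N * q) → Ternary} {b : Fin N} {a : Fin q → Ternary} :
    (∃ l ∈ (wordLits a).map (blockLit b), Formula4.litVal x l = .zero) ↔
      ∃ o s, a o = Ternary.ofBool s ∧ block x b o = Ternary.ofBool (!s) := by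
  rw [exists_mem_map_iff]
  simp only [Prod.exists, mem_wordLits, blockLit, Formula4.litVal, block]
  refine exists_congr fun o => exists_congr fun s => and_congr_right fun _ => ?_
  cases s <;> cases x (finProdFinEquiv (b, o)) <;> simp [Ternary.not, Ternary.ofBool]

theorem exists_blockDNF_eq_one {x : Fin (N * q) → Ternary} {b : Fin N}
    {A : List (Fin q → Ternary)} :
    (∃ t ∈ blockDNF b A, ∀ l ∈ t, Formula4.litVal x l = .one) ↔ Covers (block x b) A := by
  rw [blockDNF, exists_mem_map_iff]
  exact exists_congr fun a => and_congr_right fun _ => forall_litVal_eq_one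

end Blocks

namespace BlockCode

variable {q P n : ℕ} (c : BlockCode q P)

/-- The conjunction that demands of all blocks that they satisfy the function of the block. -/
noncomputable def fulls (N : ℕ) : List (List (List (Literal (N * q)))) :=
  (List.finRange N).map fun b => blockDNF b c.full

variable [NeZero P]

/-- The block of a Boolean variable. -/
def blockOf (P : ℕ) (i : Fin n) : Fin (n / P + 1) :=
  ⟨i / P, Nat.lt_succ_of_le (Nat.div_le_div_right i.2.le)⟩

/-- The place of a Boolean variable in its block. -/
def offset (P : ℕ) [NeZero P] (i : Fin n) : Fin P := ⟨i % P, Nat.mod_lt _ (NeZero.pos P)⟩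

/-- The disjunct that excludes hazards on inputs that are not code words in some block. -/
noncomputable def nonprimeConj (N : ℕ) : List (List (List (Literal (N * q)))) :=
  ((List.finRange N).flatMap fun b => blockDNF b c.nonprime) :: c.fulls N

/-- The disjunct that excludes hazards on codes of assignments that falsify the clause `C`. -/
noncomputable def clauseConj (C : List (Literal n)) :
    List (List (List (Literal ((n / P + 1) * q)))) :=
  (C.map fun l => blockDNF (blockOf P l.1) (c.falsify (offset P l.1) l.2)) ++ c.fulls _

/-- The formula whose hazards are the codes of the satisfying assignments. -/
noncomputable def formula (F : CNF n) : Formula4 ((n / P + 1) * q) :=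
  c.nonprimeConj _ :: F.clauses.map c.clauseConj

omit [NeZero P] in
theorem exists_mem_nonprime : ∃ a, a ∈ c.nonprime := by
  obtain ⟨a, ha, -⟩ := c.surj fun _ => false
  have h : Covers (fun o => Ternary.ofBool (decide (a o = .one))) c.full := by
    refine ⟨a, ha, fun o ho => ?_⟩
    cases hao : a o <;> simp_all [Ternary.ofBool]
  obtain ⟨a, ha, -⟩ := covers_nonprime_of_full h
  exact ⟨a, ha⟩

omit [NeZero P] in
theorem exists_mem_falsify (o : Fin P) (s : Bool) : ∃ a, a ∈ c.falsify o s := by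
  obtain ⟨a, ha, h⟩ := c.surj fun _ => !s
  exact ⟨a, List.mem_filter.2 ⟨ha, by simp [h]⟩⟩

omit [NeZero P] in
theorem proper_blockDNF {N : ℕ} (b : Fin N) {A : List (Fin q → Ternary)} (hA : ∃ a, a ∈ A)
    (h : ∀ a ∈ A, wordLits a ≠ []) : blockDNF b A ≠ [] ∧ ∀ t ∈ blockDNF b A, t ≠ [] := by
  obtain ⟨a, ha⟩ := hA
  refine ⟨?_, ?_⟩
  · simpa [blockDNF] using List.ne_nil_of_mem ha
  · simpa [blockDNF] using h

theorem proper_formula (F : CNF n) : (c.formula F).Proper := by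
  have hw : ∀ a ∈ c.full, wordLits a ≠ [] := fun a ha => by
    have := mem_words.1 ha
    have := c.pos
    exact wordLits_ne_nil (by omega)
  have hw' : ∀ a ∈ c.nonprime, wordLits a ≠ [] := fun a ha => by
    have := c.pos
    simp only [nonprime, List.mem_append, mem_words] at ha
    exact wordLits_ne_nil (by omega)
  have hfull : ∃ a, a ∈ c.full := by
    obtain ⟨a, ha, -⟩ := c.surj fun _ => false
    exact ⟨a, ha⟩
  have hfulls : ∀ N, ∀ B ∈ c.fulls N, B ≠ [] ∧ ∀ t ∈ B, t ≠ [] := by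
    intro N B hB
    obtain ⟨b, -, rfl⟩ := List.mem_map.1 hB
    exact proper_blockDNF b hfull hw
  refine ⟨by simp [formula], fun D hD => ?_⟩
  rw [formula, List.mem_cons, List.mem_map] at hD
  rcases hD with rfl | ⟨C, hC, rfl⟩
  · refine ⟨by simp [nonprimeConj], fun B hB => ?_⟩
    rcases List.mem_cons.1 hB with rfl | hB
    · constructor
      · obtain ⟨t, ht⟩ := List.exists_mem_of_ne_nil _
          (proper_blockDNF (0 : Fin (n / P + 1)) c.exists_mem_nonprime hw').1
        exact List.ne_nil_of_mem (List.mem_flatMap.2 ⟨0, List.mem_finRange _, ht⟩)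
      · intro t ht
        obtain ⟨b, -, ht⟩ := List.mem_flatMap.1 ht
        exact (proper_blockDNF b c.exists_mem_nonprime hw').2 t ht
    · exact hfulls _ B hB
  · refine ⟨by simp [clauseConj, fulls], fun B hB => ?_⟩
    rcases List.mem_append.1 hB with hB | hB
    · obtain ⟨l, -, rfl⟩ := List.mem_map.1 hB
      exact proper_blockDNF _ (c.exists_mem_falsify _ _) fun a ha =>
        hw a (List.mem_filter.1 ha).1
    · exact hfulls _ B hB

variable {c} {F : CNF n} {x : Fin ((n / P + 1) * q) → Ternary}

omit [NeZero P] in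
theorem forall_fulls_eq_one {N : ℕ} {x : Fin (N * q) → Ternary} :
    (∀ B ∈ c.fulls N, ∃ t ∈ B, ∀ l ∈ t, Formula4.litVal x l = .one) ↔
      ∀ b, Covers (block x b) c.full := by
  simp only [fulls, List.forall_mem_map, List.mem_finRange, forall_const, exists_blockDNF_eq_one]

theorem val_formula_eq_one : (c.formula F).val x = .one ↔
    (∀ b, Covers (block x b) c.full) ∧ ((∃ b, Covers (block x b) c.nonprime) ∨
      ∃ C ∈ F.clauses, ∀ l ∈ C,
        Covers (block x (blockOf P l.1)) (c.falsify (offset P l.1) l.2)) := by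
  rw [Formula4.val_eq_one, formula, List.exists_mem_cons_iff, exists_mem_map_iff]
  simp only [nonprimeConj, clauseConj,
    List.forall_mem_cons, List.forall_mem_append, forall_fulls_eq_one, List.forall_mem_map,
    exists_blockDNF_eq_one]
  have h : (∃ t ∈ (List.finRange (n / P + 1)).flatMap fun b => blockDNF b c.nonprime,
      ∀ l ∈ t, Formula4.litVal x l = .one) ↔ ∃ b, Covers (block x b) c.nonprime := by
    simp only [← exists_blockDNF_eq_one, List.mem_flatMap, List.mem_finRange, true_and]
    tauto
  rw [h]
  constructor
  · rintro (⟨h, h'⟩ | ⟨C, hC, h, h'⟩)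
    · exact ⟨h', .inl h⟩
    · exact ⟨h', .inr ⟨C, hC, h⟩⟩
  · rintro ⟨h', h | ⟨C, hC, h⟩⟩
    · exact .inl ⟨h, h'⟩
    · exact .inr ⟨C, hC, h, h'⟩

/-- As a Boolean function, the formula does not depend on the clauses. -/
theorem val_formula_ofBool {b : Fin ((n / P + 1) * q) → Bool} :
    (c.formula F).val (fun i => .ofBool (b i)) = .one ↔
      ∀ i, Covers (block (fun i => Ternary.ofBool (b i)) i) c.full := by
  rw [val_formula_eq_one, and_iff_left_iff_imp]
  exact fun h => .inl ⟨0, covers_nonprime_of_full (b := block b 0) (h 0)⟩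

theorem litVal_eq_zero_of_isResolution {m : ℕ} {a : Fin m → Ternary} {b : Fin m → Bool}
    (h : IsResolution a b) {l : Literal m} (hl : Formula4.litVal a l = .zero) :
    Formula4.litVal (fun i => .ofBool (b i)) l = .zero := by
  obtain ⟨i, s⟩ := l
  have := h i
  simp only [Formula4.litVal] at hl ⊢
  cases s <;> cases hai : a i <;> simp_all [Ternary.not]

/-- If no disjunct has the value `0` on `a`, then in every block some code word does not contradict
`a`, and so `a` has a resolution on which the formula is true. -/
theorem not_hasHazardAt_false (a : Fin ((n / P + 1) * q) → Ternary) :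
    ¬ ((c.formula F).circuit (c.proper_formula F)).HasHazardAt false a := by
  rintro ⟨hu, h⟩
  rw [Formula4.eval_circuit] at hu
  simp only [Formula4.eval_circuit] at h
  have h₀ : (c.formula F).val a ≠ .zero := by simp [hu]
  rw [Ne, Formula4.val_eq_zero] at h₀
  push Not at h₀
  obtain ⟨D, hD, hB⟩ := h₀
  have hfulls : ∀ B ∈ c.fulls (n / P + 1), B ∈ D := by
    intro B hB'
    rw [formula, List.mem_cons, List.mem_map] at hD
    rcases hD with rfl | ⟨C, hC, rfl⟩
    · exact List.mem_cons_of_mem _ hB'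
    · exact List.mem_append_right _ hB'
  have hw : ∀ i, ∃ w ∈ c.full, ∀ o s, w o = Ternary.ofBool s →
      block a i o ≠ Ternary.ofBool (!s) := by
    intro i
    obtain ⟨t, ht, hl⟩ := hB _ (hfulls _ (List.mem_map.2 ⟨i, List.mem_finRange _, rfl⟩))
    obtain ⟨w, hw, rfl⟩ := List.mem_map.1 ht
    refine ⟨w, hw, fun o s ho hos => ?_⟩
    obtain ⟨l, hl', hl₀⟩ := exists_litVal_eq_zero.2 ⟨o, s, ho, hos⟩
    exact hl l hl' hl₀
  choose w hw hwa using hw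
  -- Resolve the unstable values of `a` as the chosen words demand it.
  let b : Fin ((n / P + 1) * q) → Bool := fun j =>
    let io := finProdFinEquiv.symm j
    if a j = .u then decide (w io.1 io.2 = .one) else decide (a j = .one)
  have hb : IsResolution a b := by
    intro j hj
    simp only [b, if_neg hj]
    cases haj : a j <;> simp_all [Ternary.ofBool]
  have h₁ : (c.formula F).val (fun i => .ofBool (b i)) = .one := by
    refine val_formula_ofBool.2 fun i => ⟨w i, hw i, fun o ho => ?_⟩
    have h₀ := hwa i o false
    have h₁ := hwa i o true
    simp only [block, b, Equiv.symm_apply_apply] at h₀ h₁ ⊢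
    clear * - ho h₀ h₁
    cases hw : w i o <;> cases ha : a (finProdFinEquiv (i, o)) <;>
      simp_all [Ternary.ofBool]
  rw [h b hb] at h₁
  cases h₁

/-- The formula has a hazard if and only if the CNF formula is satisfiable. -/
theorem hasHazard_circuit_iff :
    ((c.formula F).circuit (c.proper_formula F)).HasHazard ↔ F.Satisfiable := by
  constructor
  · rintro (⟨a, hu, h⟩ | ⟨a, h⟩)
    swap
    · exact absurd h (not_hasHazardAt_false a)
    rw [Formula4.eval_circuit] at hu
    simp only [Formula4.eval_circuit] at h
    have hfull : ∀ i, Covers (block a i) c.full := by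
      intro i
      refine covers_full_of_resolutions fun b hb => ?_
      -- Resolve the block `i` by `b` and the other blocks arbitrarily.
      let b' : Fin ((n / P + 1) * q) → Bool := fun j =>
        let io := finProdFinEquiv.symm j
        if io.1 = i then b io.2 else decide (a j = .one)
      have hb' : IsResolution a b' := by
        intro j hj
        obtain ⟨⟨i', o⟩, rfl⟩ := finProdFinEquiv.surjective j
        simp only [b', Equiv.symm_apply_apply]
        split_ifs with hi
        · subst hi
          exact hb o hj
        · cases haj : a (finProdFinEquiv (i', o)) <;> simp_all [Ternary.ofBool]
      have := val_formula_ofBool.1 (h b' hb') i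
      have e : block (fun j => Ternary.ofBool (b' j)) i = fun o => Ternary.ofBool (b o) := by
        funext o
        simp only [block, b', Equiv.symm_apply_apply, if_true]
      rwa [e] at this
    have h₁ : (c.formula F).val a ≠ .one := by simp [hu]
    rw [Ne, val_formula_eq_one, not_and] at h₁
    have h₁ := h₁ hfull
    push Not at h₁
    have hmem : ∀ i, block a i ∈ c.full := fun i => mem_full_of_not_covers (hfull i) (h₁.1 i)
    refine ⟨fun i => c.dec (block a (blockOf P i)) (offset P i), fun C hC => ?_⟩
    obtain ⟨l, hl, h⟩ := h₁.2 C hC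
    rw [covers_falsify (hmem _), not_not] at h
    exact ⟨l, hl, h⟩
  · rintro ⟨y, hy⟩
    have := fun i : Fin (n / P + 1) => c.surj fun o : Fin P =>
      if h : P * i + o < n then y ⟨P * i + o, h⟩ else false
    choose w hw hdec using this
    let a : Fin ((n / P + 1) * q) → Ternary := fun j =>
      w (finProdFinEquiv.symm j).1 (finProdFinEquiv.symm j).2
    have ha : ∀ i, block a i = w i := by
      intro i
      funext o
      simp only [block, a, Equiv.symm_apply_apply]
    have hres : ∀ b, IsResolution a b → (c.formula F).val (fun i => .ofBool (b i)) = .one := by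
      intro b hb
      refine val_formula_ofBool.2 fun i => ⟨w i, hw i, fun o ho => ?_⟩
      have := hb (finProdFinEquiv (i, o))
      have e : a (finProdFinEquiv (i, o)) = w i o := congrFun (ha i) o
      rw [e] at this
      exact (this ho).symm
    refine .inl ⟨a, ?_, fun b hb => ?_⟩
    · rw [Formula4.eval_circuit]
      have h₁ : (c.formula F).val a ≠ .one := by
        rw [Ne, val_formula_eq_one]
        rintro ⟨-, ⟨i, h⟩ | ⟨C, hC, h⟩⟩
        · rw [ha] at h
          exact not_covers_nonprime (hw i) h
        · obtain ⟨l, hl, hyl⟩ := hy C hC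
          have := h l hl
          rw [ha, covers_falsify (hw _), hdec] at this
          refine this ?_
          have hdm : P * (blockOf P l.1 : ℕ) + (offset P l.1 : ℕ) = l.1 := Nat.div_add_mod _ _
          simp only [hdm, l.1.2, dif_pos, hyl]
      have h₀ : (c.formula F).val a ≠ .zero := by
        intro h
        have h' := hres (fun j => decide (a j = .one)) (fun j hj => by
          cases haj : a j <;> simp_all [Ternary.ofBool])
        have : (c.formula F).val (fun j => .ofBool (decide (a j = .one))) = .zero := by
          rw [Formula4.val_eq_zero] at h ⊢
          intro D hD
          obtain ⟨B, hB, hB'⟩ := h D hD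
          refine ⟨B, hB, fun t ht => ?_⟩
          obtain ⟨l, hl, hl'⟩ := hB' t ht
          refine ⟨l, hl, litVal_eq_zero_of_isResolution (fun j hj => ?_) hl'⟩
          cases haj : a j <;> simp_all [Ternary.ofBool]
        rw [h'] at this
        cases this
      cases h : (c.formula F).val a
      · exact absurd h h₀
      · exact absurd h h₁
      · rfl
    · rw [Formula4.eval_circuit]
      exact hres b hb

end BlockCode

end HazardDetection

namespace HazardDetection

/-! ### Block codes of rate close to one -/

open Filter

theorem card_words (q i j : ℕ) :
    (words q i j).length = (Finset.univ.filter fun a : Fin q → Ternary =>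
      ones a = i ∧ zeros a = j).card := by
  rw [words, Finset.length_toList]

theorem card_ternary : Fintype.card Ternary = 3 := rfl

theorem ones_le {q : ℕ} (a : Fin q → Ternary) : ones a ≤ q :=
  (Finset.card_filter_le _ _).trans (by simp)

theorem zeros_le {q : ℕ} (a : Fin q → Ternary) : zeros a ≤ q :=
  (Finset.card_filter_le _ _).trans (by simp)

/-- Some pair of numbers of ones and zeros is attained by many words. -/
theorem exists_le_length_words (q : ℕ) :
    ∃ i j, 3 ^ q ≤ (q + 1) ^ 2 * (words q i j).length := by
  have h := Finset.card_eq_sum_card_fiberwise (s := (Finset.univ : Finset (Fin q → Ternary)))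
    (f := fun a => (ones a, zeros a)) (t := Finset.range (q + 1) ×ˢ Finset.range (q + 1))
    (fun a _ => by
      have := ones_le a
      have := zeros_le a
      simp
      omega)
  rw [Finset.card_univ, Fintype.card_fun, Fintype.card_fin, card_ternary] at h
  by_contra! hlt
  have hcard : (Finset.range (q + 1) ×ˢ Finset.range (q + 1)).card = (q + 1) ^ 2 := by
    rw [Finset.card_product, Finset.card_range, sq]
  have hle : ∀ p ∈ Finset.range (q + 1) ×ˢ Finset.range (q + 1),
      (q + 1) ^ 2 * (Finset.univ.filter fun a : Fin q → Ternary => (ones a, zeros a) = p).card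
        < 3 ^ q := by
    intro p _
    have := hlt p.1 p.2
    rw [card_words] at this
    simpa only [Prod.ext_iff] using this
  have := Finset.sum_lt_sum_of_nonempty (s := Finset.range (q + 1) ×ˢ Finset.range (q + 1))
    ⟨(0, 0), by simp⟩ hle
  rw [← Finset.mul_sum, ← h, Finset.sum_const, hcard, smul_eq_mul] at this
  exact lt_irrefl _ this

/-- There are few words without unstable positions and few words without stable ones. -/
theorem length_words_le {q i j : ℕ} (h : i + j = 0 ∨ q ≤ i + j) :
    (words q i j).length ≤ 2 ^ q := by
  rw [card_words]
  rcases h with h | h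
  · refine le_trans (Finset.card_le_one.2 fun a ha b hb => ?_) Nat.one_le_two_pow
    simp only [Finset.mem_filter, Finset.mem_univ, true_and] at ha hb
    have hu : ∀ a : Fin q → Ternary, ones a = 0 → zeros a = 0 → ∀ o, a o = .u := by
      intro a h₁ h₀ o
      simp only [ones, zeros, Finset.card_eq_zero, Finset.filter_eq_empty_iff] at h₁ h₀
      have h₁ := h₁ (Finset.mem_univ o)
      have h₀ := h₀ (Finset.mem_univ o)
      cases ha : a o <;> simp_all
    funext o
    rw [hu a (by omega) (by omega), hu b (by omega) (by omega)]
  · have hinj := Finset.card_le_card_of_injOn (s := Finset.univ.filter fun a : Fin q → Ternary =>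
        ones a = i ∧ zeros a = j) (t := (Finset.univ : Finset (Fin q → Bool)))
      (fun a o => decide (a o = .one)) (fun _ _ => Finset.mem_coe.2 (Finset.mem_univ _)) ?_
    · simpa using hinj
    · intro a ha b hb hab
      simp only [Finset.coe_filter, Finset.mem_univ, true_and, Set.mem_ofPred_eq] at ha hb
      have hu : ∀ a : Fin q → Ternary, q ≤ ones a + zeros a → ∀ o, a o ≠ .u := by
        intro a h o ho
        have hd : Disjoint (Finset.univ.filter fun o => a o = .one)
            (Finset.univ.filter fun o => a o = .zero) := by
          refine Finset.disjoint_filter.2 fun o _ h h' => ?_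
          rw [h] at h'
          cases h'
        rw [ones, zeros, ← Finset.card_union_of_disjoint hd] at h
        have := Finset.eq_univ_of_card _ (le_antisymm (Finset.card_le_univ _)
          (by rwa [Fintype.card_fin]))
        have := Finset.ext_iff.1 this o
        simp [ho] at this
      funext o
      have h₁ := hu a (by omega) o
      have h₂ := hu b (by omega) o
      have h₃ := congrFun hab o
      simp only [decide_eq_decide] at h₃
      cases ha : a o <;> cases hb : b o <;> simp_all

/-- Block codes of rate arbitrarily close to one exist: the rate of a code with `2 ^ P` code words
among the `3 ^ q` ternary words of length `q` is at least `δ` if `3 ^ (δ q) ≤ 2 ^ P`. -/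
theorem exists_blockCode {δ : ℝ} (hδ : δ < 1) :
    ∃ q P : ℕ, 0 < P ∧ (3 : ℝ) ^ (δ * q) ≤ 2 ^ P ∧ Nonempty (BlockCode q P) := by
  have h₁ := tendsto_pow_const_mul_const_pow_of_abs_lt_one 2 (r := 2 / 3)
    (by rw [abs_of_pos] <;> norm_num)
  have hr : (3 : ℝ) ^ (δ - 1) < 1 := Real.rpow_lt_one_of_one_lt_of_neg (by norm_num) (by linarith)
  have h₂ := tendsto_pow_const_mul_const_pow_of_abs_lt_one 2 (r := (3 : ℝ) ^ (δ - 1))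
    (by rwa [abs_of_pos (by positivity)])
  obtain ⟨q, ⟨hq₁, hq₂⟩, hq⟩ := ((h₁.eventually_lt_const (u := 1 / 8) (by norm_num)).and
    (h₂.eventually_lt_const (u := 1 / 8) (by norm_num)) |>.and (eventually_ge_atTop 1)).exists
  obtain ⟨i, j, hij⟩ := exists_le_length_words q
  -- The length `q` is so large that there are more than `2 ^ q` of these words, which rules out
  -- that they are all stable or all unstable, and that `3 ^ ((1 - δ) q)` makes up for the
  -- polynomial loss.
  have hq' : ((q : ℝ) + 1) ^ 2 ≤ 4 * (q : ℝ) ^ 2 := by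
    have : (1 : ℝ) ≤ q := by exact_mod_cast hq
    nlinarith
  have hij' : (3 : ℝ) ^ q ≤ 4 * (q : ℝ) ^ 2 * (words q i j).length := by
    refine le_trans (by exact_mod_cast hij) (mul_le_mul_of_nonneg_right hq' (by positivity))
  have hqpos : (0 : ℝ) < (q : ℝ) ^ 2 := by positivity
  have hlarge : 2 ^ q < (words q i j).length := by
    rw [div_pow, mul_div_assoc', div_lt_iff₀ (by positivity)] at hq₁
    have : (q : ℝ) ^ 2 * 2 ^ q < (q : ℝ) ^ 2 * (words q i j).length := by nlinarith
    exact_mod_cast lt_of_mul_lt_mul_left this hqpos.le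
  have hnd : ¬ (i + j = 0 ∨ q ≤ i + j) := fun h => absurd (length_words_le h) (by omega)
  push Not at hnd
  set m := (words q i j).length with hm
  have hm0 : m ≠ 0 := ((Nat.zero_le _).trans_lt hlarge).ne'
  refine ⟨q, Nat.log 2 m, ?_, ?_, ?_⟩
  · refine Nat.log_pos (by norm_num) ?_
    have : 2 ^ 1 ≤ 2 ^ q := Nat.pow_le_pow_right (by norm_num) hq
    omega
  · have hlog : m < 2 ^ (Nat.log 2 m + 1) := Nat.lt_pow_succ_log_self (by norm_num) m
    have hlog' : (m : ℝ) < 2 * 2 ^ Nat.log 2 m := by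
      rw [← pow_succ']
      exact_mod_cast hlog
    have e : ((3 : ℝ) ^ (δ - 1)) ^ q * 3 ^ q = 3 ^ (δ * q) := by
      rw [← Real.rpow_mul_natCast (by norm_num), ← Real.rpow_natCast (3 : ℝ) q,
        ← Real.rpow_add (by norm_num)]
      congr 1
      ring
    have hpos : (0 : ℝ) < ((3 : ℝ) ^ (δ - 1)) ^ q := by positivity
    rw [← e]
    calc ((3 : ℝ) ^ (δ - 1)) ^ q * 3 ^ q
        ≤ ((3 : ℝ) ^ (δ - 1)) ^ q * (4 * (q : ℝ) ^ 2 * m) := by gcongr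
      _ = 4 * ((q : ℝ) ^ 2 * ((3 : ℝ) ^ (δ - 1)) ^ q) * m := by ring
      _ ≤ 4 * (1 / 8) * (2 * 2 ^ Nat.log 2 m) := by gcongr
      _ = 2 ^ Nat.log 2 m := by ring
  · have hcard : Fintype.card (Fin (Nat.log 2 m) → Bool) ≤
        Fintype.card {a // a ∈ words q i j} := by
      have h₁ : Fintype.card (Fin (Nat.log 2 m) → Bool) = 2 ^ Nat.log 2 m := by simp
      have h₂ : Fintype.card {a // a ∈ words q i j} = m := by
        rw [hm, card_words]
        exact (Fintype.card_congr (Equiv.subtypeEquivRight fun a => by simp [mem_words])).trans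
          (Fintype.card_coe _)
      rw [h₁, h₂]
      exact Nat.pow_log_le_self 2 hm0
    obtain ⟨g⟩ := Function.Embedding.nonempty_of_card_le hcard
    exact ⟨{
      numOnes := i
      numZeros := j
      pos := by omega
      lt := hnd.2
      dec := Function.invFun fun y => (g y : Fin q → Ternary)
      surj := fun y => ⟨g y, (g y).2,
        Function.leftInverse_invFun (fun y y' h => g.injective (Subtype.ext h)) y⟩ }⟩

end HazardDetection

namespace HazardDetection

/-! ### Basic stack programs -/

namespace Prog

variable {K : Type} [DecidableEq K]

/-- Run the programs of a list one after the other. -/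
def seqAll : List (Prog K) → Prog K := List.foldr seq skip

/-- Push `m` tallies on a stack. -/
def pushTallies (k : K) : ℕ → Prog K
  | 0 => skip
  | m + 1 => seq (push k .tally) (pushTallies k m)

/-- Empty a stack. -/
def clear (k : K) : Prog K := loop k Option.isSome (pop k)

/-- Move the symbols of the stack `k` to the stack `d`. -/
def move (k d : K) : Prog K :=
  loop k Option.isSome (case k fun a => match a with
    | some a => seq (pop k) (push d a)
    | none => skip)

/-- Whether a symbol is a tally. -/
def isTally : Option Symb → Bool
  | some .tally => true
  | _ => false

/-- Move the tallies on top of the stack `k` to the stack `d`. -/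
def moveTallies (k d : K) : Prog K := loop k isTally (seq (pop k) (push d .tally))

/-- Copy the number on the stack `k` to the stack `d`, with the help of the stack `tmp`. -/
def copy (tmp k d : K) : Prog K :=
  seq (loop k Option.isSome (seq (pop k) (seq (push tmp .tally) (push d .tally))))
    (moveTallies tmp k)

theorem Runs.cast {p : Prog K} {S S' S'' : K → List Symb} {t t' : ℕ} (h : p.Runs S S' t)
    (hS : S' = S'') (ht : t ≤ t') : p.Runs S S'' t' :=
  hS ▸ h.mono ht

theorem unary_succ (m : ℕ) : unary (m + 1) = .tally :: unary m := rfl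

theorem unary_add (m m' : ℕ) : unary (m + m') = unary m ++ unary m' :=
  List.replicate_add m m' _

theorem reverse_unary (m : ℕ) : (unary m).reverse = unary m := List.reverse_replicate

theorem cons_unary_append (m : ℕ) (l : List Symb) :
    .tally :: (unary m ++ l) = unary m ++ .tally :: l := by
  rw [← List.cons_append, ← unary_succ, unary_add, List.append_assoc]
  rfl

theorem runs_pushTallies (k : K) (m : ℕ) (S : K → List Symb) :
    (pushTallies k m).Runs S (Function.update S k (unary m ++ S k)) (m + 1) := by
  induction m generalizing S with
  | zero => exact (Runs.skip S).cast (by simp [unary]) le_rfl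
  | succ m ih =>
    refine ((Runs.push k .tally S).seq (ih _)).cast ?_ (by omega)
    rw [Function.update_self, Function.update_idem, ← cons_unary_append, unary_succ]
    rfl

theorem runs_clear (k : K) (S : K → List Symb) :
    (clear k).Runs S (Function.update S k []) (2 * (S k).length + 1) := by
  generalize hl : S k = l
  induction l generalizing S with
  | nil => exact (Runs.loop_exit (by simp [hl])).cast (by simp [← hl]) (by simp)
  | cons a l ih =>
    refine (Runs.loop_step (by simp [hl]) (Runs.pop k S) (ih _ (by simp [hl]))).cast ?_
      (by simp; omega)
    rw [Function.update_idem]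

theorem runs_move {k d : K} (hkd : k ≠ d) (S : K → List Symb) :
    (move k d).Runs S (Function.update (Function.update S k []) d ((S k).reverse ++ S d))
      (4 * (S k).length + 1) := by
  generalize hl : S k = l
  induction l generalizing S with
  | nil => exact (Runs.loop_exit (by simp [hl])).cast (by
        rw [← hl, Function.update_eq_self, hl]; simp) (by simp)
  | cons a l ih =>
    refine (Runs.loop_step (by simp [hl]) (Runs.case (t := 1 + 1)
      (S' := Function.update (Function.update S k l) d (a :: S d)) ?_)
      (ih _ (by simp [hkd]))).cast ?_ (by simp; omega)
    · simp only [hl, List.head?_cons]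
      refine ((Runs.pop k S).seq (Runs.push d a _)).cast ?_ le_rfl
      simp [hl, hkd.symm]
    · funext j
      by_cases h₁ : j = d
      · subst h₁; simp
      · by_cases h₂ : j = k
        · subst h₂; simp [h₁]
        · simp [h₁, h₂]

theorem runs_moveTallies {k d : K} (hkd : k ≠ d) (S : K → List Symb) (m : ℕ) (l : List Symb)
    (hl : isTally l.head? = false) (hk : S k = unary m ++ l) :
    (moveTallies k d).Runs S (Function.update (Function.update S k l) d (unary m ++ S d))
      (3 * m + 1) := by
  induction m generalizing S with
  | zero =>
    have hk : S k = l := hk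
    exact (Runs.loop_exit (by rw [hk, hl])).cast (by simp [← hk, unary]) (by simp)
  | succ m ih =>
    refine (Runs.loop_step (by simp [hk, unary_succ, isTally])
      ((Runs.pop k S).seq (Runs.push d .tally _)) (ih _ ?_)).cast ?_ (by omega)
    · simp [hkd, hk, unary_succ]
    · funext j
      by_cases h₁ : j = d
      · subst h₁; simp [hkd.symm, unary_succ, cons_unary_append]
      · by_cases h₂ : j = k
        · subst h₂; simp [h₁]
        · simp [h₁, h₂]

theorem runs_copy {tmp k d : K} (hkd : k ≠ d) (hkt : k ≠ tmp) (hdt : d ≠ tmp) (S : K → List Symb)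
    (m : ℕ) (hk : S k = unary m) (ht : S tmp = []) :
    (copy tmp k d).Runs S (Function.update S d (unary m ++ S d)) (7 * m + 2) := by
  have h₁ : ∀ (m : ℕ) (S : K → List Symb), S k = unary m →
      (loop k Option.isSome (seq (pop k) (seq (push tmp .tally) (push d .tally)))).Runs S
        (Function.update (Function.update (Function.update S k []) tmp (unary m ++ S tmp)) d
          (unary m ++ S d)) (4 * m + 1) := by
    intro m
    induction m with
    | zero =>
      intro S hk
      have hk : S k = [] := hk
      exact (Runs.loop_exit (by simp [hk])).cast (by
        rw [← hk, Function.update_eq_self]; simp [unary]) (by simp)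
    | succ m ih =>
      intro S hk
      refine (Runs.loop_step (by simp [hk, unary_succ]) ((Runs.pop k S).seq
        ((Runs.push tmp .tally _).seq (Runs.push d .tally _))) (ih _ ?_)).cast ?_ (by omega)
      · simp [hkd, hkt, hk, unary_succ]
      · funext j
        by_cases h₁ : j = d
        · subst h₁; simp [hkd.symm, hdt, unary_succ, cons_unary_append]
        · by_cases h₂ : j = tmp
          · subst h₂; simp [hkt.symm, hdt.symm, unary_succ, cons_unary_append]
          · by_cases h₃ : j = k
            · subst h₃; simp [h₁, h₂]
            · simp [h₁, h₂, h₃]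
  refine ((h₁ m S hk).seq (runs_moveTallies hkt.symm _ m [] rfl ?_)).cast ?_ (by omega)
  · simp [hdt.symm, ht]
  · clear h₁
    funext j
    by_cases h₁ : j = d
    · subst h₁; simp [hkd.symm, hdt]
    · by_cases h₂ : j = tmp
      · subst h₂; simp [hkt.symm, h₁, ht]
      · by_cases h₃ : j = k
        · subst h₃; simp [h₁, h₂, hk]
        · simp [h₁, h₂, h₃]

/-- Repeatedly remove as many tallies from the stack `k` as `l` has elements and run `full`; if
there are only `j` tallies left, followed by another symbol, then remove them, too, and run `exit`
for the element of `l` at the position `j`. -/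
def chunk (k : K) (full : Prog K) {α : Type} (exit : α → Prog K) : List α → Prog K
  | [] => full
  | o :: l => case k fun a => match a with
    | some .tally => seq (pop k) (chunk k full exit l)
    | _ => seq (pop k) (exit o)

/-- Division with remainder. The stack `k` holds a number of tallies and a marker. -/
def divide (k : K) (P : ℕ) (full : Prog K) (exit : Fin P → Prog K) : Prog K :=
  loop k Option.isSome (chunk k full exit (List.finRange P))

theorem runs_chunk_full {k : K} {full : Prog K} {α : Type} {exit : α → Prog K} {l : List α}
    {S S' : K → List Symb} {u : List Symb} {t : ℕ} (hk : S k = unary l.length ++ u)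
    (h : full.Runs (Function.update S k u) S' t) :
    (chunk k full exit l).Runs S S' (2 * l.length + t) := by
  induction l generalizing S with
  | nil =>
    have hk : S k = u := hk
    rw [← hk, Function.update_eq_self] at h
    exact h.mono (by simp)
  | cons o l ih =>
    rw [List.length_cons, unary_succ] at hk
    refine (Runs.case (t := 1 + (2 * l.length + t)) ?_).mono (by simp; omega)
    rw [hk]
    exact (Runs.pop k S).seq (ih (by simp [hk]) (by simpa using h))

theorem runs_chunk_exit {k : K} {full : Prog K} {α : Type} {exit : α → Prog K} {l : List α}
    {S S' : K → List Symb} {j : ℕ} (hj : j < l.length) {t : ℕ} (hk : S k = unary j ++ [Symb.or])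
    (h : (exit l[j]).Runs (Function.update S k []) S' t) :
    (chunk k full exit l).Runs S S' (2 * l.length + t) := by
  induction l generalizing S j with
  | nil => exact absurd hj (by simp)
  | cons o l ih =>
    cases j with
    | zero =>
      have hk : S k = [Symb.or] := hk
      refine (Runs.case (t := 1 + t) ?_).mono (by simp; omega)
      rw [hk]
      exact (Runs.pop k S).seq (by simpa [hk] using h)
    | succ j =>
      rw [unary_succ] at hk
      refine (Runs.case (t := 1 + (2 * l.length + t)) ?_).mono (by simp; omega)
      rw [hk]
      exact (Runs.pop k S).seq (ih (j := j) (by simpa using hj) (by simp [hk]) (by simpa using h))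

/-- The program `full` is run for every `P` tallies, and `exit` is run for the remainder. The stacks
are `S m u` after `m` runs of `full`, where `u` is the contents of the stack `k`. -/
theorem runs_divide {k : K} {P : ℕ} (hP : 0 < P) {full : Prog K} {exit : Fin P → Prog K}
    {S : ℕ → List Symb → K → List Symb} {S' : K → List Symb} {j t t' : ℕ}
    (hS : ∀ m u, S m u k = u) (hS' : ∀ m u u', Function.update (S m u) k u' = S m u')
    (hk : S' k = []) (hfull : ∀ m u, full.Runs (S m u) (S (m + 1) u) t)
    (hexit : (exit ⟨j % P, Nat.mod_lt _ hP⟩).Runs (S (j / P) []) S' t') :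
    (divide k P full exit).Runs (S 0 (unary j ++ [Symb.or])) S'
      ((2 * P + t + 1) * (j + 1) + t' + 1) := by
  suffices h : ∀ d m, d + m = j / P →
      (divide k P full exit).Runs (S m (unary (j - P * m) ++ [Symb.or])) S'
        ((2 * P + t + 1) * d + (2 * P + t') + 1 + 1) by
    refine (h (j / P) 0 (by simp)).mono ?_
    have := Nat.div_le_self j P
    nlinarith [Nat.mul_le_mul_left (2 * P + t + 1) this]
  intro d
  induction d with
  | zero =>
    intro m hm
    have hj : j - P * m = j % P := by
      have := Nat.div_add_mod j P
      rw [show m = j / P by omega]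
      omega
    rw [hj]
    refine (Runs.loop_step (t := 2 * (List.finRange P).length + t') (t' := 1) (S' := S') ?_
      (runs_chunk_exit (j := j % P) (by simpa using Nat.mod_lt _ hP) (hS _ _) ?_)
      (Runs.loop_exit (by simp [hk]))).mono (by simp)
    · rw [hS]
      cases unary (j % P) <;> rfl
    · rw [hS']
      simpa [show m = j / P by omega] using hexit
  | succ d ih =>
    intro m hm
    have hj : j - P * m = P + (j - P * (m + 1)) := by
      have h₁ := Nat.div_add_mod j P
      have h₂ : P * (m + 1) ≤ P * (j / P) := Nat.mul_le_mul_left _ (by omega)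
      rw [Nat.mul_add] at h₂ ⊢
      omega
    refine (Runs.loop_step (p := chunk k full exit (List.finRange P)) (k := k)
      (c := Option.isSome) (S'' := S') (t := 2 * (List.finRange P).length + t)
      (t' := (2 * P + t + 1) * d + (2 * P + t') + 1 + 1)
      (S' := S (m + 1) (unary (j - P * (m + 1)) ++ [Symb.or])) ?_
      (runs_chunk_full (u := unary (j - P * (m + 1)) ++ [Symb.or]) ?_ ?_)
      (ih (m + 1) (by omega))).mono ?_
    · rw [hS]
      cases unary (j - P * m) <;> rfl
    · rw [hS, hj, unary_add, List.length_finRange, List.append_assoc]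
    · rw [hS']
      exact hfull _ _
    · simp only [List.length_finRange]
      nlinarith

end Prog

end HazardDetection

namespace HazardDetection

/-! ### Emitting gates -/

/-- The stacks of the program for the reduction. -/
inductive Stk
  /-- the input -/
  | inp
  /-- the output, last symbol on top -/
  | out
  /-- the number of the gates in the output, in unary -/
  | cnt
  /-- the number of the first variable of the current block, in unary -/
  | base
  /-- the number of the blocks, in unary -/
  | blocks
  /-- a loop counter, in unary -/
  | itr
  /-- a number that is to be divided -/
  | idx
  /-- auxiliary stack -/
  | tmp
  /-- the wires from gates of a given level that have not been connected yet -/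
  | wires (i : Fin 5)
  deriving DecidableEq, Fintype

/-- The contents of the stacks between two instructions of the program for the reduction. -/
structure St where
  /-- the rest of the input -/
  inp : List Symb
  /-- the output, in reading direction -/
  out : List Symb
  /-- the number of the gates in the output -/
  cnt : ℕ
  /-- the number of the first variable of the current block -/
  base : ℕ
  /-- the number of the blocks -/
  blocks : ℕ
  /-- a loop counter -/
  itr : ℕ
  /-- a number that is to be divided -/
  idx : List Symb
  /-- for each level, the gates that have not been connected yet, last one first -/
  w : Fin 5 → List ℕ

namespace St

/-- The contents of the stacks. -/
def get (s : St) : Stk → List Symb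
  | .inp => s.inp
  | .out => s.out.reverse
  | .cnt => unary s.cnt
  | .base => unary s.base
  | .blocks => unary s.blocks
  | .itr => unary s.itr
  | .idx => s.idx
  | .tmp => []
  | .wires i => encodeWires (s.w i)

theorem update_inp (s : St) (u : List Symb) :
    Function.update s.get .inp u = { s with inp := u }.get := by
  funext k; cases k <;> simp [get]

theorem update_out (s : St) (u : List Symb) :
    Function.update s.get .out u.reverse = { s with out := u }.get := by
  funext k; cases k <;> simp [get]

theorem update_cnt (s : St) (m : ℕ) :
    Function.update s.get .cnt (unary m) = { s with cnt := m }.get := by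
  funext k; cases k <;> simp [get]

theorem update_base (s : St) (m : ℕ) :
    Function.update s.get .base (unary m) = { s with base := m }.get := by
  funext k; cases k <;> simp [get]

theorem update_blocks (s : St) (m : ℕ) :
    Function.update s.get .blocks (unary m) = { s with blocks := m }.get := by
  funext k; cases k <;> simp [get]

theorem update_itr (s : St) (m : ℕ) :
    Function.update s.get .itr (unary m) = { s with itr := m }.get := by
  funext k; cases k <;> simp [get]

theorem update_idx (s : St) (u : List Symb) :
    Function.update s.get .idx u = { s with idx := u }.get := by
  funext k; cases k <;> simp [get]

theorem update_wires (s : St) (i : Fin 5) (ws : List ℕ) :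
    Function.update s.get (.wires i) (encodeWires ws) =
      { s with w := Function.update s.w i ws }.get := by
  funext k
  cases k with
  | wires j =>
    by_cases h : j = i
    · subst h; simp [get]
    · simp [get, h]
  | _ => simp [get]

variable {n : ℕ}

/-- Add gates to the output and wires at the level `i`. -/
def add (s : St) (i : Fin 5) (gs : List (Gate n)) (ws : List ℕ) : St :=
  { s with
    out := s.out ++ gs.flatMap Gate.encode
    cnt := s.cnt + gs.length
    w := Function.update s.w i (ws ++ s.w i) }

end St

namespace Prog

open St

/-- Write the gate for a literal at the place `l.1` of the current block. -/
def emitLit (l : ℕ × Bool) : Prog Stk :=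
  seq (push .out (if l.2 then .pos else .neg)) (seq (copy .tmp .base .out)
    (seq (pushTallies .out l.1) (seq (copy .tmp .cnt (.wires 0))
      (seq (push (.wires 0) .wire) (push .cnt .tally)))))

/-- Write the gate for the operation `a` with the inputs given by the wires of the level `i`, and
add its own wire at the level `j`. -/
def emitGate (a : Symb) (i j : Fin 5) : Prog Stk :=
  seq (push .out a) (seq (move (.wires i) .out) (seq (copy .tmp .cnt (.wires j))
      (seq (push (.wires j) .wire) (push .cnt .tally))))

theorem runs_push_out (s : St) (a : Symb) :
    (push .out a).Runs s.get { s with out := s.out ++ [a] }.get 1 := by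
  refine (Runs.push .out a s.get).cast ?_ le_rfl
  rw [← update_out s (s.out ++ [a])]
  simp [St.get]

theorem runs_push_cnt (s : St) :
    (push .cnt .tally).Runs s.get { s with cnt := s.cnt + 1 }.get 1 := by
  refine (Runs.push .cnt .tally s.get).cast ?_ le_rfl
  rw [← update_cnt s (s.cnt + 1)]
  rfl

theorem runs_pushTallies_out (s : St) (m : ℕ) :
    (pushTallies .out m).Runs s.get { s with out := s.out ++ unary m }.get (m + 1) := by
  refine (runs_pushTallies .out m s.get).cast ?_ le_rfl
  rw [← update_out s (s.out ++ unary m), List.reverse_append, reverse_unary]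
  rfl

theorem runs_copy_out (s : St) :
    (copy .tmp .base .out).Runs s.get { s with out := s.out ++ unary s.base }.get
      (7 * s.base + 2) := by
  refine (runs_copy (by simp) (by simp) (by simp) s.get s.base rfl rfl).cast ?_ le_rfl
  rw [← update_out s (s.out ++ unary s.base), List.reverse_append, reverse_unary]
  rfl

/-- Adding a wire from the gate that comes next. -/
theorem runs_wire (s : St) (i : Fin 5) :
    (seq (copy .tmp .cnt (.wires i)) (seq (push (.wires i) .wire) (push .cnt .tally))).Runs s.get
      { s with cnt := s.cnt + 1, w := Function.update s.w i (s.cnt :: s.w i) }.get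
      (7 * s.cnt + 4) := by
  have h₁ := runs_copy (tmp := .tmp) (k := .cnt) (d := .wires i) (by simp) (by simp) (by simp) s.get
    s.cnt rfl rfl
  have h₂ := Runs.push (.wires i) .wire (Function.update s.get (.wires i)
    (unary s.cnt ++ s.get (.wires i)))
  have h₃ := update_wires s i (s.cnt :: s.w i)
  rw [Function.update_self, Function.update_idem, show Symb.wire ::
    (unary s.cnt ++ s.get (.wires i)) = encodeWires (s.cnt :: s.w i) from rfl, h₃] at h₂
  exact (h₁.seq (h₂.seq (runs_push_cnt _))).mono (by omega)

theorem runs_emitLit (s : St) (o : ℕ) (b : Bool) :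
    (emitLit (o, b)).Runs s.get
      { s with
        out := s.out ++ (if b then Symb.pos else Symb.neg) :: unary (s.base + o)
        cnt := s.cnt + 1
        w := Function.update s.w 0 (s.cnt :: s.w 0) }.get
      (7 * s.base + 7 * s.cnt + o + 8) := by
  refine ((runs_push_out s _).seq ((runs_copy_out _).seq ((runs_pushTallies_out _ o).seq
    (runs_wire _ 0)))).cast ?_ (by simp only; omega)
  simp [unary_add]

theorem runs_move_wires (s : St) (i : Fin 5) :
    (move (.wires i) .out).Runs s.get
      { s with out := s.out ++ encodeWires (s.w i), w := Function.update s.w i [] }.get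
      (4 * (encodeWires (s.w i)).length + 1) := by
  refine (runs_move (by simp) s.get).cast ?_ le_rfl
  have h₁ := update_wires s i []
  have h₂ := update_out { s with w := Function.update s.w i [] } (s.out ++ encodeWires (s.w i))
  rw [show encodeWires [] = [] from rfl] at h₁
  rw [h₁, ← h₂, List.reverse_append]
  rfl

theorem runs_emitGate (s : St) (a : Symb) {i j : Fin 5} (hij : i ≠ j) :
    (emitGate a i j).Runs s.get
      { s with
        out := s.out ++ a :: encodeWires (s.w i)
        cnt := s.cnt + 1
        w := Function.update (Function.update s.w i []) j (s.cnt :: s.w j) }.get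
      (4 * (encodeWires (s.w i)).length + 7 * s.cnt + 6) := by
  refine ((runs_push_out s a).seq ((runs_move_wires _ i).seq (runs_wire _ j))).cast ?_
    (by simp only; omega)
  simp [hij.symm]

section Emits

variable {n : ℕ} {α β : Type}

/-- Provided that the stacks hold the numbers `v` (the first variable of the current block),
`b` (the number of blocks) and `k` (a loop counter), the program `p` reads the input from `u` up to
`u'` and writes the gates of the formulas in the list `l`, leaving behind wires at the level `i`.
It spends at most `A * (N + 1)` steps for each of these gates, plus `r` additional ones, where `N`
bounds both `M` and the number of all gates written so far. The stacks of wires below the level `i`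
have to be empty. -/
def Emits (M v b k : ℕ) (u u' : List Symb) (p : Prog Stk) (i : Fin 5)
    (f : α → ℕ → List (Gate n)) (l : List α) (A r : ℕ) : Prop :=
  ∀ (s : St) (N : ℕ), s.base = v → s.blocks = b → s.itr = k → s.inp = u → s.idx = [] →
    (∀ j < i, s.w j = []) → M ≤ N → s.cnt + (layList f l s.cnt).length ≤ N →
    p.Runs s.get { s.add i (layList f l s.cnt) (layOuts f l s.cnt) with inp := u' }.get
      (A * (layList f l s.cnt).length * (N + 1) + r)

variable {M v b k A r : ℕ} {u u' : List Symb} {p : Prog Stk} {i : Fin 5}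
  {f : α → ℕ → List (Gate n)} {l : List α}

theorem Emits.mono {A' r' : ℕ} (h : Emits M v b k u u' p i f l A r) (hA : A ≤ A') (hr : r ≤ r') :
    Emits M v b k u u' p i f l A' r' := by
  intro s N h₁ h₂ h₃ h₄ h₅ h₆ h₇ h₈
  refine (h s N h₁ h₂ h₃ h₄ h₅ h₆ h₇ h₈).mono ?_
  gcongr

/-- If at least one gate is written, then the additional steps may be charged to that gate. -/
theorem Emits.absorb (h : Emits M v b k u u' p i f l A r) (hl : l ≠ [])
    (hf : ∀ x ∈ l, ∀ c, f x c ≠ []) : Emits M v b k u u' p i f l (A + r) 0 := by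
  intro s N h₁ h₂ h₃ h₄ h₅ h₆ h₇ h₈
  refine (h s N h₁ h₂ h₃ h₄ h₅ h₆ h₇ h₈).mono ?_
  have hpos : 1 ≤ (layList f l s.cnt).length := by
    obtain ⟨x, l', rfl⟩ := List.exists_cons_of_ne_nil hl
    have := List.length_pos_iff.2 (hf x (by simp) s.cnt)
    simp only [layList, List.length_append]
    omega
  have : r * 1 * 1 ≤ r * (layList f l s.cnt).length * (N + 1) := by gcongr; omega
  nlinarith

theorem Emits.seq {u'' : List Symb} {q : Prog Stk} {l' : List α} {r' : ℕ}
    (h : Emits M v b k u u' p i f l A r) (h' : Emits M v b k u' u'' q i f l' A r') :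
    Emits M v b k u u'' (seq p q) i f (l ++ l') A (r + r') := by
  intro s N h₁ h₂ h₃ h₄ h₅ h₆ h₇ h₈
  rw [layList_append, List.length_append] at h₈
  refine ((h s N h₁ h₂ h₃ h₄ h₅ h₆ h₇ (by omega)).seq
    (h' _ N h₁ h₂ h₃ rfl h₅ ?_ h₇ (by simp only [St.add]; omega))).cast ?_ ?_
  · intro j hj
    simp [St.add, hj.ne, h₆ j hj]
  · simp [St.add, layList_append, layOuts_append]
    congr 1
    simp [add_assoc]
  · rw [layList_append, List.length_append]
    simp only [St.add]
    apply le_of_eq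
    ring

theorem Emits.skip : Emits M v b k u u skip i f [] A 1 := by
  intro s N h₁ h₂ h₃ h₄ h₅ h₆ h₇ h₈
  refine (Runs.skip s.get).cast ?_ (by simp)
  subst h₄
  simp [St.add, layList, layOuts]

theorem Emits.seqAll {β : Type} {P : β → Prog Stk} {g : β → α} {l : List β}
    (h : ∀ x ∈ l, Emits M v b k u u (P x) i f [g x] A 0) :
    Emits M v b k u u (seqAll (l.map P)) i f (l.map g) A 1 := by
  induction l with
  | nil => exact Emits.skip
  | cons x l ih =>
    have := (h x (by simp)).seq (ih fun y hy => h y (by simp [hy]))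
    rw [zero_add] at this
    exact this

theorem length_encodeWires_le {N : ℕ} {ws : List ℕ} (h : ∀ j ∈ ws, j ≤ N) :
    (encodeWires ws).length ≤ ws.length * (N + 1) := by
  induction ws with
  | nil => simp [encodeWires]
  | cons j ws ih =>
    have h₁ := ih fun j hj => h j (by simp [hj])
    have h₂ := h j (by simp)
    have : (encodeWires (j :: ws)).length = j + 1 + (encodeWires ws).length := by
      simp [encodeWires, unary]
      omega
    rw [this, List.length_cons]
    nlinarith

theorem layOuts_bounds (hf : ∀ x ∈ l, ∀ c, f x c ≠ []) (c : ℕ) :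
    (layOuts f l c).length ≤ (layList f l c).length ∧
      ∀ j ∈ layOuts f l c, j ≤ c + (layList f l c).length := by
  induction l generalizing c with
  | nil => simp [layOuts, layList]
  | cons x l ih =>
    obtain ⟨h₁, h₂⟩ := ih (fun y hy => hf y (by simp [hy])) (c + (f x c).length)
    have := List.length_pos_iff.2 (hf x (by simp) c)
    simp only [layOuts, layList, List.length_append, List.length_singleton, List.mem_append,
      List.mem_singleton]
    refine ⟨by omega, ?_⟩
    rintro j (hj | rfl)
    · have := h₂ j hj
      omega
    · omega

/-- Writing a list of formulas, followed by the gate that combines them. -/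
theorem Emits.layNode {op : List ℕ → Gate n} {a : Symb}
    (hop : ∀ js, (op js).encode = a :: encodeWires js) {j : Fin 5} (hij : ∀ i', i' < j ↔ i' ≤ i)
    (h : Emits M v b k u u' p i f l A r) (hf : ∀ x ∈ l, ∀ c, f x c ≠ []) :
    Emits M v b k u u' (Prog.seq p (emitGate a i j)) j (layNode op f) [l] (A + r + 17) 0 := by
  have hne : i ≠ j := ((hij i).2 le_rfl).ne
  intro s N h₁ h₂ h₃ h₄ h₅ h₆ h₇ h₈
  simp only [layList, HazardDetection.layNode, List.append_nil, List.length_append,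
    List.length_singleton] at h₈ ⊢
  have hwi : s.w i = [] := h₆ i ((hij i).2 le_rfl)
  refine ((h s N h₁ h₂ h₃ h₄ h₅ (fun i' hi' => h₆ i' ((hij i').2 hi'.le)) h₇ (by omega)).seq
    (runs_emitGate _ a hne)).cast ?_ ?_
  · have hup : Function.update s.w i [] = s.w := by rw [← hwi, Function.update_eq_self]
    simp [St.add, hop, layOuts, hwi, HazardDetection.layNode, add_assoc, hup, hne.symm]
  · have hb := layOuts_bounds hf s.cnt
    have := length_encodeWires_le (N := N) (ws := layOuts f l s.cnt)
      fun j hj => (hb.2 j hj).trans (by omega)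
    simp only [St.add, Function.update_self, hwi, List.append_nil]
    generalize (layList f l s.cnt).length = m at *
    have h₁ : (encodeWires (layOuts f l s.cnt)).length ≤ m * (N + 1) :=
      this.trans (Nat.mul_le_mul_right _ hb.1)
    have h₂ : 7 * (s.cnt + m) ≤ 7 * (N + 1) := by omega
    have h₃ : r * 1 ≤ r * (N + 1) := Nat.mul_le_mul_left _ (by omega)
    nlinarith [Nat.zero_le (m * N), Nat.zero_le (r * m * N),
      Nat.zero_le (r * m), Nat.zero_le (A * N)]

end Emits

end Prog

end HazardDetection

namespace HazardDetection

namespace Prog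

open St Formula4

/-! ### The program for the reduction -/

section Loops

variable {n : ℕ} {α β : Type} {M v b k A r : ℕ} {u u' : List Symb} {p : Prog Stk} {i : Fin 5}
  {f : α → ℕ → List (Gate n)} {l : List α}

theorem layNode_ne_nil (op : List ℕ → Gate n) (f : α → ℕ → List (Gate n)) (l : List α) (c : ℕ) :
    layNode op f l c ≠ [] := by
  simp [layNode]

theorem length_layOuts (f : α → ℕ → List (Gate n)) (l : List α) (c : ℕ) :
    (layOuts f l c).length = l.length := by
  induction l generalizing c with
  | nil => rfl
  | cons x l ih => simp [layOuts, ih]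

theorem length_le_length_layList (hf : ∀ x ∈ l, ∀ c, f x c ≠ []) (c : ℕ) :
    l.length ≤ (layList f l c).length :=
  length_layOuts f l c ▸ (layOuts_bounds hf c).1

theorem Emits.case {ps : Option Symb → Prog Stk} (h : Emits M v b k u u' (ps u.head?) i f l A r) :
    Emits M v b k u u' (.case .inp ps) i f l A (r + 1) := by
  intro s N h₁ h₂ h₃ h₄ h₅ h₆ h₇ h₈
  have := h s N h₁ h₂ h₃ h₄ h₅ h₆ h₇ h₈
  subst h₄
  exact Runs.case this

theorem Emits.pop_inp (a : Symb) : Emits M v b k (a :: u) u (.pop .inp) i f [] A 1 := by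
  intro s N h₁ h₂ h₃ h₄ h₅ h₆ h₇ h₈
  refine (Runs.pop .inp s.get).cast ?_ ?_
  · rw [show (s.get .inp).tail = u by simp [St.get, h₄], update_inp]
    simp [St.add, layList, layOuts]
  · omega

/-- Reading and processing a list of items, as long as the next symbol shows that there are more of
them. The predicate `ok` describes the possible continuations of the input. -/
theorem Emits.loop {c : Option Symb → Bool} {e : β → List Symb} {g : β → α} {l : List β}
    {ok : List Symb → Prop} {rest : List Symb} (hf : ∀ x c, f x c ≠ [])
    (hok : ∀ x u, ok (e x ++ u)) (hc : ∀ x u, c (e x ++ u).head? = true) (hrest : ok rest)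
    (hcr : c rest.head? = false)
    (h : ∀ x ∈ l, ∀ u, ok u → Emits M v b k (e x ++ u) u p i f [g x] A 0) :
    Emits M v b k (l.flatMap e ++ rest) rest (.loop .inp c p) i f (l.map g) (A + 1) 1 := by
  induction l with
  | nil =>
    intro s N h₁ h₂ h₃ h₄ h₅ h₆ h₇ h₈
    have h₄ : s.inp = rest := h₄
    refine (Runs.loop_exit (by subst h₄; exact hcr)).cast ?_ (by simp)
    subst h₄
    simp [St.add, layList, layOuts]
  | cons x l ih =>
    intro s N h₁ h₂ h₃ h₄ h₅ h₆ h₇ h₈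
    rw [List.flatMap_cons, List.append_assoc] at h₄
    rw [List.map_cons, show g x :: l.map g = [g x] ++ l.map g from rfl, layList_append,
      List.length_append] at h₈
    have hok' : ok (l.flatMap e ++ rest) := by
      cases l with
      | nil => exact hrest
      | cons y l => rw [List.flatMap_cons, List.append_assoc]; exact hok _ _
    refine (Runs.loop_step (by subst h₁; rw [show s.get .inp = s.inp from rfl, h₄]; exact hc _ _)
      (h x (by simp) _ hok' s N h₁ h₂ h₃ h₄ h₅ h₆ h₇ (by omega))
      (ih (fun y hy => h y (by simp [hy])) _ N h₁ h₂ h₃ rfl h₅ ?_ h₇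
        (by simp only [St.add]; omega))).cast ?_ ?_
    · intro j hj
      simp [St.add, hj.ne, h₆ j hj]
    · rw [List.map_cons, show g x :: l.map g = [g x] ++ l.map g from rfl, layList_append,
        layOuts_append]
      simp [St.add]
      congr 1
      simp [add_assoc]
    · rw [List.map_cons, show g x :: l.map g = [g x] ++ l.map g from rfl, layList_append,
        List.length_append]
      simp only [St.add]
      have hpos : 1 ≤ (layList f [g x] s.cnt).length :=
        length_le_length_layList (l := [g x]) (fun x _ => hf x) s.cnt
      nlinarith [Nat.zero_le ((layList f [g x] s.cnt).length * N)]

/-- Run `p` for all blocks, with the number of the first variable of the block on the stack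
`base`. -/
def forBlocks (q : ℕ) (p : Prog Stk) : Prog Stk :=
  seq (copy .tmp .blocks .itr) (seq
    (.loop .itr Option.isSome (seq (pop .itr) (seq p (pushTallies .base q)))) (clear .base))

theorem runs_copy_itr (s : St) (h : s.itr = 0) :
    (copy .tmp .blocks .itr).Runs s.get { s with itr := s.blocks }.get (7 * s.blocks + 2) := by
  refine (runs_copy (by simp) (by simp) (by simp) s.get s.blocks rfl rfl).cast ?_ le_rfl
  rw [← update_itr s s.blocks, show s.get .itr = unary s.itr from rfl, h,
    show unary 0 = [] from rfl, List.append_nil]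

theorem runs_clear_base (s : St) :
    (clear .base).Runs s.get { s with base := 0 }.get (2 * s.base + 1) := by
  refine (runs_clear .base s.get).cast (update_base s 0) ?_
  simp [St.get, unary]

theorem runs_pop_itr (s : St) (m : ℕ) (h : s.itr = m + 1) :
    (pop .itr).Runs s.get { s with itr := m }.get 1 := by
  refine (Runs.pop .itr s.get).cast ?_ le_rfl
  rw [← update_itr s m, show s.get .itr = unary s.itr from rfl, h]
  rfl

theorem runs_pushTallies_base (s : St) (m : ℕ) :
    (pushTallies .base m).Runs s.get { s with base := m + s.base }.get (m + 1) := by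
  refine (runs_pushTallies .base m s.get).cast ?_ le_rfl
  rw [← update_base s (m + s.base), unary_add]
  rfl

/-- The loop over the blocks, from the block `b₀` on. -/
theorem runs_forBlocks_loop {q : ℕ} {g : Fin b → List α}
    (h : ∀ (x : Fin b) (k : ℕ), Emits M (q * x) b k u u p i f (g x) A r)
    {bs : List (Fin b)} {b₀ : ℕ}
    (hbs : bs.map (fun x : Fin b => (x : ℕ)) = List.range' b₀ bs.length) (s : St) (N : ℕ)
    (h₁ : s.base = q * b₀) (h₂ : s.blocks = b) (h₃ : s.itr = bs.length) (h₄ : s.inp = u)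
    (h₅ : s.idx = []) (h₆ : ∀ j < i, s.w j = []) (h₇ : M ≤ N)
    (h₈ : s.cnt + (layList f (bs.flatMap g) s.cnt).length ≤ N) :
    (Prog.loop .itr Option.isSome (seq (pop .itr) (seq p (pushTallies .base q)))).Runs s.get
      { s.add i (layList f (bs.flatMap g) s.cnt) (layOuts f (bs.flatMap g) s.cnt) with
        base := q * (b₀ + bs.length), itr := 0 }.get
      (A * (layList f (bs.flatMap g) s.cnt).length * (N + 1) + (r + q + 3) * bs.length + 1) := by
  induction bs generalizing b₀ s with
  | nil =>
    refine (Runs.loop_exit (by simp [St.get, h₃, unary])).cast ?_ (by simp)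
    cases s
    simp_all [St.add, layList, layOuts]
  | cons x bs ih =>
    rw [List.map_cons, List.length_cons, List.range'_succ, List.cons.injEq] at hbs
    obtain ⟨rfl, hbs⟩ := hbs
    rw [List.flatMap_cons, layList_append, List.length_append] at h₈
    have e₁ := runs_pop_itr s bs.length h₃
    have e₂ := h x bs.length { s with itr := bs.length } N h₁ h₂ rfl h₄ h₅ h₆ h₇
      (by simp only; omega)
    have e₃ := runs_pushTallies_base { ({ s with itr := bs.length } : St).add i
      (layList f (g x) s.cnt) (layOuts f (g x) s.cnt) with inp := u } q
    have e₄ := ih hbs (by simp only [h₁]; ring) h₂ rfl rfl h₅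
      (by intro j hj; simp [St.add, hj.ne, h₆ j hj]) (by simp only [St.add]; omega) (s :=
        { ({ s with itr := bs.length } : St).add i (layList f (g x) s.cnt)
          (layOuts f (g x) s.cnt) with inp := u, base := q + s.base })
    refine (Runs.loop_step (by rw [show s.get .itr = unary s.itr from rfl, h₃]; rfl)
      (e₁.seq (e₂.seq e₃)) e₄).cast ?_ ?_
    · rw [List.flatMap_cons, layList_append, layOuts_append]
      have e : (x : ℕ) + 1 + bs.length = x + (bs.length + 1) := by ring
      simp [St.add, h₄, e]
      congr 1
      simp [add_assoc]
    · rw [List.flatMap_cons, layList_append, List.length_append, List.length_cons]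
      simp only [St.add]
      apply le_of_eq
      ring

theorem Emits.forBlocks {q : ℕ} {g : Fin b → List α} (hi : ∀ x, g x ≠ [])
    (hf : ∀ x c, f x c ≠ []) (h : ∀ (x : Fin b) (k : ℕ), Emits M (q * x) b k u u p i f (g x) A r) :
    Emits M 0 b 0 u u (forBlocks q p) i f ((List.finRange b).flatMap g) (A + r + 3 * q + 10) 4 := by
  intro s N h₁ h₂ h₃ h₄ h₅ h₆ h₇ h₈
  have e₁ := runs_copy_itr s h₃
  have e₂ := runs_forBlocks_loop h (bs := List.finRange b) (b₀ := 0)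
    (by simp [List.range_eq_range']) { s with itr := s.blocks } N (by simp [h₁]) h₂ (by simp [h₂])
    h₄ h₅ h₆ h₇ h₈
  refine (e₁.seq (e₂.seq (runs_clear_base _))).cast ?_ ?_
  · simp [St.add, h₁, h₃, h₄]
  · simp only [List.length_finRange, zero_add, h₂]
    -- Every block contributes a gate, which pays for the overhead of the loop.
    have hb : b ≤ (layList f ((List.finRange b).flatMap g) s.cnt).length := by
      refine le_trans ?_ (length_le_length_layList (fun x _ => hf x) s.cnt)
      rw [List.length_flatMap]
      refine le_trans (by simp) (List.card_nsmul_le_sum _ 1 ?_)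
      intro m hm
      obtain ⟨x, -, rfl⟩ := List.mem_map.1 hm
      exact List.length_pos_iff.2 (hi x)
    generalize (layList f ((List.finRange b).flatMap g) s.cnt).length = m at *
    have h₁ : (r + 3 * q + 10) * b ≤ (r + 3 * q + 10) * (m * (N + 1)) :=
      Nat.mul_le_mul_left _ (by nlinarith)
    nlinarith

end Loops

end Prog

end HazardDetection

namespace HazardDetection

namespace Prog

open St Formula4

section Programs

variable {q P : ℕ}

/-- Write the gates for the terms of some words in the current block. -/
def termsProg (A : List (Fin q → Ternary)) : Prog Stk :=
  seqAll (A.map fun a =>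
    seq (seqAll ((wordLits a).map fun l => emitLit (l.1, l.2))) (emitGate .and 0 1))

/-- Write the gates for the formula demanding that the current block refines one of some words. -/
def dnfProg (A : List (Fin q → Ternary)) : Prog Stk := seq (termsProg A) (emitGate .or 1 2)

/-- Move a number from the input to the stack `idx`, with a marker below it. -/
def readIdx : Prog Stk := seq (push .idx .or) (moveTallies .inp .idx)

variable (c : BlockCode q P)

/-- Write the disjunct that excludes inputs that are not code words in some block. -/
noncomputable def nonprimeProg : Prog Stk :=
  seq (seq (seq (forBlocks q (termsProg c.nonprime)) (emitGate .or 1 2))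
    (forBlocks q (dnfProg c.full))) (emitGate .and 2 3)

/-- Read a literal with the sign `s` and write the gates for its falsification. -/
noncomputable def litProg (s : Bool) : Prog Stk :=
  seq (pop .inp) (seq readIdx
    (seq (divide .idx P (pushTallies .base q) fun o => dnfProg (c.falsify o s)) (clear .base)))

/-- Whether a symbol is the sign of a literal. -/
def isSign : Option Symb → Bool
  | some .pos => true
  | some .neg => true
  | _ => false

/-- Read a clause and write the disjunct for it. -/
noncomputable def clauseProg : Prog Stk :=
  seq (seq (seq (pop .inp) (loop .inp isSign (case .inp fun a => match a with
    | some .pos => litProg c true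
    | _ => litProg c false))) (forBlocks q (dnfProg c.full))) (emitGate .and 2 3)

/-- Read the clauses and write the formula. -/
noncomputable def formulaProg : Prog Stk :=
  seq (seq (nonprimeProg c) (loop .inp Option.isSome (clauseProg c))) (emitGate .or 3 4)

/-- The program for the reduction: compute the number of blocks, write the number of variables,
write the formula, and tidy up. -/
noncomputable def reductionProg : Prog Stk :=
  seq readIdx (seq (divide .idx P (push .blocks .tally) fun _ => push .blocks .tally)
    (seq (copy .tmp .blocks .itr)
      (seq (loop .itr Option.isSome (seq (pop .itr) (pushTallies .out q)))
        (seq (formulaProg c) (seq (clear .cnt) (seq (clear .blocks) (clear (.wires 4))))))))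

end Programs

section Correctness

variable {q P M b k : ℕ} {u : List Symb}

theorem emits_emitLit (x : Fin b) (hM : q * x ≤ M) (l : Fin q × Bool) :
    Emits M (q * x) b k u u (emitLit (l.1, l.2)) 0 layLit [blockLit x l] (22 + q) 0 := by
  obtain ⟨o, sg⟩ := l
  intro s N h₁ h₂ h₃ h₄ h₅ h₆ h₇ h₈
  refine (runs_emitLit s o sg).cast ?_ ?_
  · simp [St.add, layList, layOuts, layLit, Gate.encode, encodeLit, blockLit, h₁, h₄, add_comm]
  · simp only [layList, layLit, List.append_nil, List.length_singleton] at h₈ ⊢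
    have := o.2
    nlinarith

theorem emits_termsProg (x : Fin b) (hM : q * x ≤ M) (A : List (Fin q → Ternary)) :
    Emits M (q * x) b k u u (termsProg A) 1 layTerm (blockDNF x A) (40 + q) 1 := by
  refine Emits.seqAll fun a _ => ?_
  refine (Emits.layNode (fun _ => rfl) (by decide) (Emits.seqAll fun l _ => emits_emitLit x hM l)
    fun _ _ _ => by simp [layLit]).mono (by omega) le_rfl

theorem emits_dnfProg (x : Fin b) (hM : q * x ≤ M) (A : List (Fin q → Ternary)) :
    Emits M (q * x) b k u u (dnfProg A) 2 layDNF [blockDNF x A] (58 + q) 0 :=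
  (Emits.layNode (fun _ => rfl) (by decide) (emits_termsProg x hM A)
    fun _ _ _ => layNode_ne_nil _ _ _ _).mono (by omega) le_rfl

theorem mul_le_of_fin (x : Fin b) (hM : q * b ≤ M) : q * x ≤ M :=
  (Nat.mul_le_mul_left _ x.2.le).trans hM

variable (c : BlockCode q P)

theorem emits_fulls (hM : q * b ≤ M) :
    Emits M 0 b 0 u u (forBlocks q (dnfProg c.full)) 2 layDNF (c.fulls b) (68 + 4 * q) 4 := by
  have := Emits.forBlocks (f := layDNF) (g := fun x : Fin b => [blockDNF x c.full])
    (fun _ => by simp) (fun _ _ => layNode_ne_nil _ _ _ _) fun x k =>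
      emits_dnfProg (k := k) (u := u) x (mul_le_of_fin x hM) c.full
  rw [← List.map_eq_flatMap] at this
  exact this.mono (by omega) le_rfl

theorem emits_nonprimeProg (hM : q * b ≤ M) :
    Emits M 0 b 0 u u (nonprimeProg c) 3 layConj [c.nonprimeConj b] (93 + 4 * q) 0 := by
  have h₁ := Emits.forBlocks (f := layTerm) (g := fun x : Fin b => blockDNF x c.nonprime)
    (fun x => by
      obtain ⟨a, ha⟩ := c.exists_mem_nonprime
      simpa [blockDNF] using List.ne_nil_of_mem ha)
    (fun _ _ => layNode_ne_nil _ _ _ _) fun x k =>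
      emits_termsProg (k := k) (u := u) x (mul_le_of_fin x hM) c.nonprime
  have h₂ := Emits.layNode (op := .or) (fun _ => rfl) (j := 2) (by decide) h₁
    fun _ _ _ => layNode_ne_nil _ _ _ _
  have h₃ := (h₂.mono (A' := 72 + 4 * q) (by omega) le_rfl).seq
    ((emits_fulls c hM).mono (by omega) le_rfl)
  exact (Emits.layNode (fun _ => rfl) (by decide) h₃ fun _ _ _ => layNode_ne_nil _ _ _ _).mono
    (by omega) le_rfl

theorem runs_readIdx (s : St) {m : ℕ} (h : s.inp = unary m ++ u) (hi : s.idx = [])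
    (hu : isTally u.head? = false) :
    readIdx.Runs s.get { s with inp := u, idx := unary m ++ [Symb.or] }.get (3 * m + 2) := by
  refine ((Runs.push .idx .or s.get).seq
    (runs_moveTallies (k := .inp) (d := .idx) (by simp) _ m u hu ?_)).cast ?_ ?_
  · simp [St.get, h]
  · rw [Function.update_self, show s.get .idx = [] from hi, update_idx, update_inp, update_idx]
  · omega

variable [NeZero P] {n : ℕ}

open BlockCode

theorem emits_litProg (l : Literal n) (hM : q * (n / P + 1) ≤ M) (hn : n ≤ M)
    (hu : isTally u.head? = false) :
    Emits M 0 (n / P + 1) k (encodeLit l.1 l.2 ++ u) u (litProg c l.2) 2 layDNF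
      [blockDNF (blockOf P l.1) (c.falsify (offset P l.1) l.2)] (78 + 2 * q + 2 * P) 0 := by
  obtain ⟨i, sg⟩ := l
  intro s N h₁ h₂ h₃ h₄ h₅ h₆ h₇ h₈
  set B := blockDNF (blockOf P i) (c.falsify (offset P i) sg)
  have e₁ : (pop .inp).Runs s.get { s with inp := unary i ++ u }.get 1 := by
    refine (Runs.pop .inp s.get).cast ?_ le_rfl
    rw [← update_inp s (unary i ++ u), show s.get .inp = s.inp from rfl, h₄]
    rfl
  have e₂ := runs_readIdx { s with inp := unary i ++ u } (u := u) (m := i) rfl h₅ hu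
  have e₃ := emits_dnfProg (q := q) (k := k) (u := u) (blockOf P i) (mul_le_of_fin _ hM)
    (c.falsify (offset P i) sg) { s with inp := u, base := q * (i / P) } N rfl h₂ h₃ rfl h₅ h₆ h₇ h₈
  have e₄ := runs_divide (P := P) (NeZero.pos P) (k := .idx) (full := pushTallies .base q)
    (exit := fun o => dnfProg (c.falsify o sg)) (j := i) (t := q + 1)
    (S := fun m u' => { s with inp := u, base := q * m, idx := u' }.get)
    (S' := { ({ s with inp := u, base := q * (i / P) } : St).add 2
      (layList layDNF [B] s.cnt) (layOuts layDNF [B] s.cnt) with inp := u }.get)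
    (t' := (58 + q) * (layList layDNF [B] s.cnt).length * (N + 1) + 0)
    (fun _ _ => rfl) (fun _ _ _ => update_idx _ _) (by exact h₅)
    (fun m u' => (runs_pushTallies_base _ q).cast
      (by simp only [Nat.mul_add, mul_one, add_comm]) le_rfl)
    (by rw [← h₅]; exact e₃)
  have e₅ := runs_clear_base ({ ({ s with inp := u, base := q * (i / P) } : St).add 2
    (layList layDNF [B] s.cnt) (layOuts layDNF [B] s.cnt) with inp := u })
  have h₀ : ({ s with inp := u, idx := unary i ++ [Symb.or] } : St) =
    { s with inp := u, base := q * 0, idx := unary i ++ [Symb.or] } := by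
    rw [mul_zero, ← h₁]
  refine (e₁.seq (e₂.seq ((h₀ ▸ e₄).seq e₅))).cast ?_ ?_
  · simp [St.add, h₁]
  · have hpos : 1 ≤ (layList layDNF [B] s.cnt).length :=
      length_le_length_layList (l := [B]) (fun _ _ _ => layNode_ne_nil _ _ _ _) s.cnt
    have hi := i.2
    have hb : q * (i / P) ≤ N := (mul_le_of_fin (blockOf P i) hM).trans h₇
    change 1 + (3 * (i : ℕ) + 2 + ((2 * P + (q + 1) + 1) * ((i : ℕ) + 1) +
      ((58 + q) * (layList layDNF [B] s.cnt).length * (N + 1) + 0) + 1 + (2 * (q * (i / P)) + 1))) ≤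
      (78 + 2 * q + 2 * P) * (layList layDNF [B] s.cnt).length * (N + 1) + 0
    generalize (layList layDNF [B] s.cnt).length = m at *
    have h₁ : (2 * P + (q + 1) + 1) * ((i : ℕ) + 1) ≤ (2 * P + q + 2) * (m * (N + 1)) :=
      Nat.mul_le_mul (by omega) (by nlinarith)
    have h₂ : N + 1 ≤ m * (N + 1) := by nlinarith
    nlinarith

theorem emits_clauseProg (C : List (Literal n)) (hM : q * (n / P + 1) ≤ M) (hn : n ≤ M)
    (hu : isTally u.head? = false) (hu' : isSign u.head? = false) :
    Emits M 0 (n / P + 1) 0 ((Symb.or :: C.flatMap fun l => encodeLit l.1 l.2) ++ u) u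
      (clauseProg c) 3 layConj [c.clauseConj C] (103 + 4 * q + 2 * P) 0 := by
  have h₁ : Emits M 0 (n / P + 1) 0 ((C.flatMap fun l => encodeLit l.1 l.2) ++ u) u
      (loop .inp isSign (case .inp fun a => match a with
        | some .pos => litProg c true
        | _ => litProg c false)) 2 layDNF
      (C.map fun l => blockDNF (blockOf P l.1) (c.falsify (offset P l.1) l.2))
      (79 + 2 * q + 2 * P + 1) 1 := by
    refine Emits.loop (ok := fun u => isTally u.head? = false) (fun _ _ => layNode_ne_nil _ _ _ _)
      ?_ ?_ hu hu' ?_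
    · rintro ⟨i, _ | _⟩ u <;> rfl
    · rintro ⟨i, _ | _⟩ u <;> rfl
    · rintro ⟨i, sg⟩ _ u hu
      refine ((Emits.case ?_).absorb (by simp) (fun _ _ _ => layNode_ne_nil _ _ _ _)).mono
        (A := 78 + 2 * q + 2 * P + (0 + 1)) (by omega) le_rfl
      cases sg
      · exact emits_litProg c (i, false) hM hn hu
      · exact emits_litProg c (i, true) hM hn hu
  have h₂ := ((Emits.pop_inp (A := 80 + 4 * q + 2 * P) .or).seq (h₁.mono (by omega) le_rfl)).seq
    ((emits_fulls c hM).mono (by omega) le_rfl)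
  exact (Emits.layNode (fun _ => rfl) (by decide) h₂ fun _ _ _ => layNode_ne_nil _ _ _ _).mono
    (by omega) le_rfl

theorem emits_formulaProg (F : CNF n) (hM : q * (n / P + 1) ≤ M) (hn : n ≤ M) :
    Emits M 0 (n / P + 1) 0
      (F.clauses.flatMap fun C => Symb.or :: C.flatMap fun l => encodeLit l.1 l.2) []
      (formulaProg c) 4 lay [c.formula F] (122 + 4 * q + 2 * P) 0 := by
  have h₁ : Emits M 0 (n / P + 1) 0
      ((F.clauses.flatMap fun C => Symb.or :: C.flatMap fun l => encodeLit l.1 l.2) ++ []) []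
      (loop .inp Option.isSome (clauseProg c)) 3 layConj (F.clauses.map c.clauseConj)
      (103 + 4 * q + 2 * P + 1) 1 :=
    Emits.loop (ok := fun u => isTally u.head? = false ∧ isSign u.head? = false)
      (fun _ _ => layNode_ne_nil _ _ _ _) (fun _ _ => ⟨rfl, rfl⟩) (fun _ _ => rfl) ⟨rfl, rfl⟩ rfl
      fun C _ u hu => emits_clauseProg c C hM hn hu.1 hu.2
  rw [List.append_nil] at h₁
  have h₂ := ((emits_nonprimeProg c hM).mono (by omega) le_rfl).seq h₁
  exact (Emits.layNode (fun _ => rfl) (by decide) h₂ fun _ _ _ => layNode_ne_nil _ _ _ _).mono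
    (by omega) le_rfl

end Correctness

end Prog

end HazardDetection

namespace HazardDetection

namespace Prog

open St Formula4 BlockCode

theorem runs_clear_cnt (s : St) :
    (clear .cnt).Runs s.get { s with cnt := 0 }.get (2 * s.cnt + 1) := by
  refine (runs_clear .cnt s.get).cast (update_cnt s 0) ?_
  simp [St.get, unary]

theorem runs_clear_blocks (s : St) :
    (clear .blocks).Runs s.get { s with blocks := 0 }.get (2 * s.blocks + 1) := by
  refine (runs_clear .blocks s.get).cast (update_blocks s 0) ?_
  simp [St.get, unary]

theorem runs_clear_wires (s : St) (i : Fin 5) :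
    (clear (.wires i)).Runs s.get { s with w := Function.update s.w i [] }.get
      (2 * (encodeWires (s.w i)).length + 1) :=
  (runs_clear (.wires i) s.get).cast (update_wires s i []) le_rfl

/-- The loop that writes the number of variables of the formula. -/
theorem runs_header (q : ℕ) (s : St) (m : ℕ) (h : s.itr = m) :
    (Prog.loop .itr Option.isSome (seq (pop .itr) (pushTallies .out q))).Runs s.get
      { s with out := s.out ++ unary (m * q), itr := 0 }.get ((q + 3) * m + 1) := by
  induction m generalizing s with
  | zero =>
    refine (Runs.loop_exit (by simp [St.get, h, unary])).cast ?_ (by simp)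
    cases s
    simp_all [unary]
  | succ m ih =>
    refine (Runs.loop_step (by rw [show s.get .itr = unary s.itr from rfl, h]; rfl)
      ((runs_pop_itr s m h).seq (runs_pushTallies_out _ q)) (ih _ rfl)).cast ?_ ?_
    · rw [Nat.succ_mul, add_comm, unary_add]
      simp
    · apply le_of_eq
      ring

variable {q P n : ℕ} (c : BlockCode q P) [NeZero P]

/-- The program computes the reduction, in time polynomial in the size of the formula. -/
theorem runs_reductionProg (F : CNF n) :
    (reductionProg c).Runs (Function.update (fun _ => []) .inp (encodeCNF ⟨n, F⟩))
      (Function.update (fun _ => []) .out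
        (encodeCircuit ⟨_, (c.formula F).circuit (c.proper_formula F)⟩).reverse)
      ((200 + 10 * q + 10 * P) * ((c.formula F).lay 0).length *
        (q * (n / P + 1) + n + ((c.formula F).lay 0).length + 1)) := by
  set E := F.clauses.flatMap fun C => Symb.or :: C.flatMap fun l => encodeLit l.1 l.2
  set G := (c.formula F).lay 0 with hG
  let s₀ : St := ⟨encodeCNF ⟨n, F⟩, [], 0, 0, 0, 0, [], fun _ => []⟩
  have hE : isTally E.head? = false := by
    simp only [E]
    cases F.clauses <;> rfl
  have e₁ := runs_readIdx s₀ (u := E) (m := n) rfl rfl hE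
  have e₂ := runs_divide (P := P) (NeZero.pos P) (k := .idx) (full := push .blocks .tally)
    (exit := fun _ => push .blocks .tally) (j := n) (t := 1) (t' := 1)
    (S := fun m u' => { s₀ with inp := E, blocks := m, idx := u' }.get)
    (S' := { s₀ with inp := E, blocks := n / P + 1 }.get)
    (fun _ _ => rfl) (fun _ _ _ => update_idx _ _) rfl
    (fun m u' => (Runs.push Stk.blocks .tally _).cast (update_blocks _ (m + 1)) le_rfl)
    ((Runs.push Stk.blocks .tally _).cast (update_blocks _ (n / P + 1)) le_rfl)
  have e₃ := runs_copy_itr { s₀ with inp := E, blocks := n / P + 1 } rfl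
  have e₄ := runs_header q { s₀ with inp := E, blocks := n / P + 1, itr := n / P + 1 } _ rfl
  have e₅ := emits_formulaProg c F (M := q * (n / P + 1) + n) (by omega) (by omega)
    { s₀ with inp := E, blocks := n / P + 1, out := [] ++ unary ((n / P + 1) * q) }
    (q * (n / P + 1) + n + G.length) rfl rfl rfl rfl rfl (fun _ _ => rfl) (by omega)
    (by simp only [layList, List.append_nil, s₀, ← hG]; omega)
  have e₆ := e₅.seq ((runs_clear_cnt _).seq ((runs_clear_blocks _).seq (runs_clear_wires _ 4)))
  have hin : Function.update (fun _ => []) Stk.inp (encodeCNF ⟨n, F⟩) = s₀.get := by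
    funext k
    cases k <;> simp [s₀, St.get, unary, encodeWires]
  rw [hin]
  refine (e₁.seq (e₂.seq (e₃.seq (e₄.seq e₆)))).cast ?_ ?_
  · funext k
    cases k with
    | wires i =>
      by_cases hi : i = 4
      · subst hi; simp [St.get, encodeWires]
      · simp [St.get, encodeWires, St.add, hi, s₀]
    | out =>
      simp [St.get, St.add, s₀, layList, encodeCircuit, circuit]
    | _ => simp [St.get, St.add, s₀, unary]
  · have hpos : 1 ≤ G.length := by
      simp [hG, lay, layNode]
    have hb : n / P ≤ n := Nat.div_le_self n P
    have hw : (encodeWires (layOuts lay [c.formula F] 0)).length ≤ G.length := by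
      simp [layOuts, encodeWires, unary, ← hG]
      omega
    clear e₁ e₂ e₃ e₄ e₅ e₆ hin
    simp only [St.add, s₀, layList, List.append_nil, ← hG, Function.update_self, zero_add]
    generalize (encodeWires (layOuts lay [c.formula F] 0)).length = w at hw ⊢
    generalize G.length = g at hw hpos ⊢
    generalize n / P = b at hb ⊢
    have h₁ : (2 * P + 2 + q + 30) * (n + 1) ≤
        (2 * P + 2 + q + 30) * (g * (q * (b + 1) + n + g + 1)) :=
      Nat.mul_le_mul_left _ (by nlinarith [Nat.zero_le (q * (b + 1))])
    have h₂ : 4 * g * 1 ≤ 4 * g * (q * (b + 1) + n + g + 1) := by gcongr; omega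
    have h₃ : (q + 30) * b ≤ (q + 30) * n := Nat.mul_le_mul_left _ hb
    nlinarith

end Prog

end HazardDetection

namespace HazardDetection

open Formula4

/-! ### The size of the formula -/

section Size

variable {n : ℕ} {α : Type}

theorem length_layList_le {f : α → ℕ → List (Gate n)} {l : List α} {B : ℕ}
    (h : ∀ x ∈ l, ∀ c, (f x c).length ≤ B) (c : ℕ) : (layList f l c).length ≤ l.length * B := by
  induction l generalizing c with
  | nil => simp [layList]
  | cons x l ih =>
    have h₁ := h x (by simp) c
    have h₂ := ih (fun y hy => h y (by simp [hy])) (c + (f x c).length)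
    rw [layList, List.length_append, List.length_cons, Nat.succ_mul]
    omega

theorem length_layNode_le {op : List ℕ → Gate n} {f : α → ℕ → List (Gate n)} {l : List α} {B : ℕ}
    (h : ∀ x ∈ l, ∀ c, (f x c).length ≤ B) (c : ℕ) :
    (layNode op f l c).length ≤ l.length * B + 1 := by
  rw [layNode, List.length_append, List.length_singleton]
  exact Nat.succ_le_succ (length_layList_le h c)

theorem length_layDNF_le {q : ℕ} {B : List (List (Literal n))} (h : ∀ t ∈ B, t.length ≤ q) (c : ℕ) :
    (layDNF B c).length ≤ B.length * (q + 1) + 1 :=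
  length_layNode_le (fun t ht c => (length_layNode_le (B := 1) (fun _ _ _ => le_rfl) c).trans
    (by have := h t ht; omega)) c

theorem length_wordLits_le {q : ℕ} (a : Fin q → Ternary) : (wordLits a).length ≤ q :=
  (List.length_filterMap_le _ _).trans (by simp)

theorem length_layDNF_blockDNF_le {q N : ℕ} (b : Fin N) (A : List (Fin q → Ternary)) (c : ℕ) :
    (layDNF (blockDNF b A) c).length ≤ A.length * (q + 1) + 1 := by
  refine (length_layDNF_le (q := q) (fun t ht => ?_) c).trans (by simp [blockDNF])
  obtain ⟨a, -, rfl⟩ := List.mem_map.1 ht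
  simpa using length_wordLits_le a

/-- A formula without repeated clauses has only polynomially many clauses of a given width. -/
theorem CNF.IsWidth.length_clauses_le {F : CNF n} {k : ℕ} (hF : F.IsWidth k) :
    F.clauses.length ≤ (2 * n + 1) ^ k := by
  classical
  have h : F.clauses.toFinset.card ≤ (Finset.univ : Finset (Fin k → Option (Literal n))).card := by
    refine Finset.card_le_card_of_injOn (fun C i => C[(i : ℕ)]?)
      (fun _ _ => Finset.mem_coe.2 (Finset.mem_univ _)) ?_
    intro C hC C' hC' h
    have h₁ := hF C (by simpa using hC)
    have h₂ := hF C' (by simpa using hC')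
    refine List.ext_getElem? fun i => ?_
    by_cases hi : i < k
    · exact congrFun h ⟨i, hi⟩
    · rw [List.getElem?_eq_none (by omega), List.getElem?_eq_none (by omega)]
  rw [List.toFinset_card_of_nodup F.clauses_nodup] at h
  refine h.trans (le_of_eq ?_)
  simp [mul_comm]

variable {q P : ℕ} (c : BlockCode q P) [NeZero P]

/-- The size of the formula for a CNF formula of width `k` is polynomial in the number `n` of its
variables. -/
theorem BlockCode.exists_length_lay_formula_le (k : ℕ) :
    ∃ A : ℕ, ∀ (n : ℕ) (F : CNF n), F.IsWidth k →
      ((c.formula F).lay 0).length ≤ A * (n + 1) ^ (k + 1) := by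
  set W := c.full.length + c.nonprime.length with hW
  -- A bound for the size of the disjunction of terms that belongs to a block.
  set D := W * (q + 1) + 1 with hD
  refine ⟨2 * D + 4 + 2 ^ k * ((k + 1) * D + 1), fun n F hF => ?_⟩
  have hD₁ : c.full.length * (q + 1) + 1 ≤ D := by rw [hD, hW]; gcongr; omega
  have hb : n / P + 1 ≤ n + 1 := Nat.succ_le_succ (Nat.div_le_self n P)
  have hfull : ∀ B ∈ c.fulls (n / P + 1), ∀ c, (layDNF B c).length ≤ D := by
    intro B hB c
    obtain ⟨b, -, rfl⟩ := List.mem_map.1 hB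
    exact (length_layDNF_blockDNF_le _ _ _).trans hD₁
  have hfulls : (c.fulls (n / P + 1)).length = n / P + 1 := by simp [BlockCode.fulls]
  have h₁ : ∀ m, (layConj (c.nonprimeConj (n / P + 1)) m).length ≤ (n + 1) * (2 * D) + 2 := by
    intro m
    have h₀ : ∀ m, (layDNF ((List.finRange (n / P + 1)).flatMap fun b =>
        blockDNF b c.nonprime) m).length ≤
        (n / P + 1) * c.nonprime.length * (q + 1) + 1 := by
      intro m
      refine (length_layDNF_le (q := q) (fun t ht => ?_) m).trans ?_
      · obtain ⟨b, -, ht⟩ := List.mem_flatMap.1 ht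
        obtain ⟨a, -, rfl⟩ := List.mem_map.1 ht
        simpa using length_wordLits_le a
      · simp [List.length_flatMap, blockDNF]
    have h₂ := length_layList_le hfull (m +
      (layDNF ((List.finRange (n / P + 1)).flatMap fun b => blockDNF b c.nonprime) m).length)
    have h₃ := h₀ m
    simp only [layConj, layNode, BlockCode.nonprimeConj, layList, List.length_append,
      List.length_singleton]
    rw [hfulls] at h₂
    have h₄ : (n / P + 1) * c.nonprime.length * (q + 1) ≤ (n + 1) * D := by
      rw [mul_assoc]
      refine Nat.mul_le_mul hb ?_
      rw [hD, hW]
      nlinarith [Nat.zero_le (c.full.length * (q + 1))]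
    have h₅ : (n / P + 1) * D ≤ (n + 1) * D := Nat.mul_le_mul_right _ hb
    nlinarith
  have h₂ : ∀ C ∈ F.clauses, ∀ m,
      (layConj (c.clauseConj C) m).length ≤ (n + 1) * ((k + 1) * D + 1) := by
    intro C hC m
    refine (length_layNode_le (B := D) (fun B hB m => ?_) m).trans ?_
    · rcases List.mem_append.1 hB with hB | hB
      · obtain ⟨l, -, rfl⟩ := List.mem_map.1 hB
        refine (length_layDNF_blockDNF_le _ _ _).trans (le_trans ?_ hD₁)
        gcongr
        exact List.length_filter_le _ _
      · exact hfull B hB m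
    · have := hF C hC
      rw [BlockCode.clauseConj, List.length_append, List.length_map, hfulls]
      have h₃ : (C.length + (n / P + 1)) * D ≤ ((n + 1) * (k + 1)) * D :=
        Nat.mul_le_mul_right _ (by nlinarith)
      nlinarith
  have h₃ := length_layList_le (f := layConj) (l := F.clauses.map c.clauseConj)
    (B := (n + 1) * ((k + 1) * D + 1)) (by
      intro B hB
      obtain ⟨C, hC, rfl⟩ := List.mem_map.1 hB
      exact h₂ C hC) (0 + (layConj (c.nonprimeConj (n / P + 1)) 0).length)
  have h₄ := h₁ 0
  have h₅ : F.clauses.length ≤ 2 ^ k * (n + 1) ^ k := by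
    rw [← mul_pow]
    exact hF.length_clauses_le.trans (Nat.pow_le_pow_left (by omega) k)
  have h₆ : 1 ≤ (n + 1) ^ k := Nat.one_le_pow _ _ (by omega)
  have h₇ : F.clauses.length * ((n + 1) * ((k + 1) * D + 1)) ≤
      2 ^ k * (n + 1) ^ k * ((n + 1) * ((k + 1) * D + 1)) := Nat.mul_le_mul_right _ h₅
  have h₈ : n + 1 ≤ (n + 1) ^ (k + 1) := by rw [pow_succ]; nlinarith
  have h₉ : (n + 1) * (2 * D + 4) ≤ (n + 1) ^ (k + 1) * (2 * D + 4) := Nat.mul_le_mul_right _ h₈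
  rw [List.length_map] at h₃
  simp only [lay, layNode, BlockCode.formula, layList, List.length_append, List.length_singleton]
  calc _ ≤ (n + 1) * (2 * D + 4) + 2 ^ k * (n + 1) ^ k * ((n + 1) * ((k + 1) * D + 1)) := by
        nlinarith
    _ ≤ _ := by rw [pow_succ] at h₉ ⊢; nlinarith

end Size

/-! ### Running times -/

theorem DecidableInTime.mono {α : Type} {enc : α → List Symb} {S S' L : Set α} {T T' : α → ℝ}
    (h : DecidableInTime enc S L T) (hS : S' ⊆ S) (hT : ∀ x ∈ S', T x ≤ T' x) :
    DecidableInTime enc S' L T' := by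
  obtain ⟨M, hM, h⟩ := h
  refine ⟨M, hM, fun x hx => ?_⟩
  obtain ⟨t, ht, h⟩ := h x (hS hx)
  exact ⟨t, ht.trans (hT x hx), h⟩

theorem HazardSolvableInTime.mono {S S' : Set (Σ n, Circuit n)} {ε : ℝ}
    (h : HazardSolvableInTime S ε) (hS : S' ⊆ S) : HazardSolvableInTime S' ε := by
  obtain ⟨K, d, h⟩ := h
  exact ⟨K, d, h.mono hS fun _ _ => le_rfl⟩

theorem exists_pow_le_mul_two_rpow (e : ℕ) {η : ℝ} (hη : 0 < η) :
    ∃ A : ℝ, 0 < A ∧ ∀ n : ℕ, ((n : ℝ) + 1) ^ e ≤ A * (2 : ℝ) ^ (η * n) := by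
  have hr : (1 : ℝ) < 2 ^ η := Real.one_lt_rpow (by norm_num) hη
  obtain ⟨A, hA, h⟩ := Asymptotics.bound_of_isBigO_nat_atTop
    (isLittleO_pow_const_const_pow_of_one_lt (R := ℝ) e hr).isBigO
  refine ⟨A * 2 ^ η, by positivity, fun n => ?_⟩
  have := h (x := n + 1) (by positivity)
  rw [Real.norm_of_nonneg (by positivity), Real.norm_of_nonneg (by positivity)] at this
  push_cast at this
  refine this.trans (le_of_eq ?_)
  rw [pow_succ, ← Real.rpow_mul_natCast (by norm_num)]
  ring

end HazardDetection

namespace HazardDetection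

open Formula4

/-- A fast algorithm for hazards in formulas of depth four yields a fast algorithm for
satisfiability, where the exponential part of the running time is kept apart from a polynomial. -/
theorem HazardSolvableInTime.decidableInTime_cnfsat {ε : ℝ} (hε : ε ≤ 1)
    (h : HazardSolvableInTime {C | C.2.IsOrAndOrAnd} ε) {q P : ℕ} (hP : 0 < P)
    (c : BlockCode q P) (k : ℕ) :
    ∃ (A : ℝ) (e : ℕ), 0 ≤ A ∧ DecidableInTime encodeCNF {F | F.2.IsWidth k} CNFSAT (fun F =>
      A * ((F.1 : ℝ) + 1) ^ e * (3 : ℝ) ^ ((1 - ε) * ((F.1 / P : ℕ) * q))) := by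
  have : NeZero P := ⟨hP.ne'⟩
  obtain ⟨K, d, h⟩ := h
  obtain ⟨A, hA⟩ := c.exists_length_lay_formula_le k
  have h' := DecidableInTime.of_reduction (Prog.reductionProg c) .inp .out (by simp)
    (S := {F | F.2.IsWidth k}) (L := CNFSAT)
    (fun F : Σ n, CNF n => ⟨_, (c.formula F.2).circuit (c.proper_formula F.2)⟩) _
    (fun F _ => isOrAndOrAnd_circuit (c.proper_formula F.2))
    (fun F _ => BlockCode.hasHazard_circuit_iff)
    (fun F _ => Prog.runs_reductionProg c F.2) h
  set B : ℝ := 2 * ((200 + 10 * q + 10 * P) * A * (q + A + 1)) + 1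
  refine ⟨B + |K| * 3 ^ ((1 - ε) * q) * A ^ d, max (2 * (k + 1)) ((k + 1) * d), by positivity,
    h'.mono subset_rfl fun F hF => ?_⟩
  obtain ⟨n, F⟩ := F
  have hG := hA n F hF
  simp only [Circuit.size, circuit]
  set G := ((c.formula F).lay 0).length
  set y : ℝ := (n : ℝ) + 1 with hy
  set e := max (2 * (k + 1)) ((k + 1) * d)
  have hy₁ : 1 ≤ y := by simp [hy]
  have hG' : (G : ℝ) ≤ A * y ^ (k + 1) := by
    rw [hy]
    exact_mod_cast hG
  have hE : 1 ≤ (3 : ℝ) ^ ((1 - ε) * ((n / P : ℕ) * q)) :=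
    Real.one_le_rpow (by norm_num) (mul_nonneg (by linarith) (by positivity))
  set E : ℝ := (3 : ℝ) ^ ((1 - ε) * ((n / P : ℕ) * q)) with hEdef
  have h₁ : 2 * (((200 + 10 * q + 10 * P) * G * (q * (n / P + 1) + n + G + 1) : ℕ) : ℝ) + 1 ≤
      B * y ^ e * E := by
    have hb : ((n / P : ℕ) : ℝ) ≤ n := by exact_mod_cast Nat.div_le_self n P
    have hyk : y ≤ y ^ (k + 1) := le_self_pow₀ hy₁ (by omega)
    have h₂ : (q * ((n / P : ℕ) + 1) + n + G + 1 : ℝ) ≤ (q + A + 1) * y ^ (k + 1) := by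
      have : (q : ℝ) * ((n / P : ℕ) + 1) ≤ q * y ^ (k + 1) := by gcongr; linarith
      nlinarith
    have h₃ : (200 + 10 * q + 10 * P : ℝ) * G * (q * ((n / P : ℕ) + 1) + n + G + 1) ≤
        (200 + 10 * q + 10 * P) * (A * y ^ (k + 1)) * ((q + A + 1) * y ^ (k + 1)) := by gcongr
    have h₄ : y ^ (2 * (k + 1)) ≤ y ^ e := pow_le_pow_right₀ hy₁ (le_max_left _ _)
    have h₅ : 1 ≤ y ^ (2 * (k + 1)) := one_le_pow₀ hy₁
    have hB : 0 ≤ B := by positivity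
    calc _ ≤ B * y ^ (2 * (k + 1)) := by
          push_cast
          rw [two_mul (k + 1), pow_add] at h₅ ⊢
          simp only [B]
          nlinarith
      _ ≤ B * y ^ e * 1 := by rw [mul_one]; gcongr
      _ ≤ _ := by gcongr
  have h₂ : K * (3 : ℝ) ^ ((1 - ε) * (((n / P + 1) * q : ℕ) : ℝ)) * (G : ℝ) ^ d ≤
      |K| * 3 ^ ((1 - ε) * q) * A ^ d * y ^ e * E := by
    have h₃ : (3 : ℝ) ^ ((1 - ε) * (((n / P + 1) * q : ℕ) : ℝ)) = 3 ^ ((1 - ε) * q) * E := by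
      rw [hEdef, ← Real.rpow_add (by norm_num)]
      congr 1
      push_cast
      ring
    have h₄ : (G : ℝ) ^ d ≤ A ^ d * y ^ e := by
      calc (G : ℝ) ^ d ≤ (A * y ^ (k + 1)) ^ d := by gcongr
        _ = A ^ d * y ^ ((k + 1) * d) := by rw [mul_pow, pow_mul]
        _ ≤ _ :=
          mul_le_mul_of_nonneg_left (pow_le_pow_right₀ hy₁ (le_max_right _ _)) (by positivity)
    rw [h₃]
    calc _ ≤ |K| * (3 ^ ((1 - ε) * q) * E) * (A ^ d * y ^ e) := by
          gcongr
          exact le_abs_self K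
      _ = _ := by ring
  calc _ ≤ B * y ^ e * E + |K| * 3 ^ ((1 - ε) * q) * A ^ d * y ^ e * E := add_le_add h₁ h₂
    _ = _ := by ring

/-- The saving in the exponent may be assumed to be small. -/
theorem HazardSolvableInTime.min {S : Set (Σ n, Circuit n)} {ε : ℝ} (h : HazardSolvableInTime S ε)
    (ε' : ℝ) : HazardSolvableInTime S (min ε ε') := by
  obtain ⟨K, d, h⟩ := h
  refine ⟨|K|, d, h.mono subset_rfl fun C _ => ?_⟩
  have : (1 - ε) * (C.1 : ℝ) ≤ (1 - Min.min ε ε') * C.1 := by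
    have := min_le_left ε ε'
    gcongr
  gcongr
  · exact le_abs_self K
  · norm_num

theorem not_hazardSolvableInTime_isOrAndOrAnd (hSETH : SETH) {ε : ℝ} (hε : 0 < ε) :
    ¬ HazardSolvableInTime {C | C.2.IsOrAndOrAnd} ε := by
  intro h
  replace h := h.min (1 / 2)
  have hε₀ : 0 < min ε (1 / 2) := lt_min hε (by norm_num)
  have hε₁ : min ε (1 / 2) ≤ 1 / 2 := min_le_right _ _
  generalize min ε (1 / 2) = η at *
  obtain ⟨k, -, hk⟩ := hSETH (η / 4) (by linarith)
  -- The rate of the code is chosen so that it costs only half of the gain `η` in the exponent.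
  have hη : 0 < 1 - η / 2 := by linarith
  obtain ⟨q, P, hP, hqP, ⟨c⟩⟩ := exists_blockCode (δ := (1 - η) / (1 - η / 2))
    ((div_lt_one hη).2 (by linarith))
  obtain ⟨A, e, hA, h⟩ := h.decidableInTime_cnfsat (by linarith) hP c k
  -- Another quarter of it pays for the polynomial factor.
  obtain ⟨A', hA', hpow⟩ := exists_pow_le_mul_two_rpow e (η := η / 4) (by linarith)
  refine hk ⟨A * A', h.mono subset_rfl ?_⟩
  rintro ⟨n, F⟩ -
  have h₁ : (3 : ℝ) ^ ((1 - η) * ((n / P : ℕ) * q)) ≤ 2 ^ ((1 - η / 2) * n) := by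
    calc (3 : ℝ) ^ ((1 - η) * ((n / P : ℕ) * q))
        = ((3 : ℝ) ^ ((1 - η) / (1 - η / 2) * q)) ^ ((1 - η / 2) * (n / P : ℕ)) := by
          rw [← Real.rpow_mul (by norm_num)]
          congr 1
          rw [mul_mul_mul_comm, div_mul_cancel₀ _ hη.ne']
          ring
      _ ≤ ((2 : ℝ) ^ P) ^ ((1 - η / 2) * (n / P : ℕ)) :=
          Real.rpow_le_rpow (by positivity) hqP (by positivity)
      _ = 2 ^ ((1 - η / 2) * ((n / P * P : ℕ) : ℝ)) := by
          rw [← Real.rpow_natCast, ← Real.rpow_mul (by norm_num)]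
          congr 1
          push_cast
          ring
      _ ≤ _ := by
          have := Nat.div_mul_le_self n P
          gcongr
          norm_num
  calc A * ((n : ℝ) + 1) ^ e * 3 ^ ((1 - η) * ((n / P : ℕ) * q))
      ≤ A * (A' * 2 ^ (η / 4 * n)) * 2 ^ ((1 - η / 2) * n) := by
        gcongr
        exact hpow n
    _ = A * A' * 2 ^ ((1 - η / 4) * n) := by
        rw [← mul_assoc, mul_assoc, ← Real.rpow_add (by norm_num)]
        congr 2
        ring

end HazardDetection

theorem mainTheorem1 (hSETH : HazardDetection.SETH) (ε : ℝ) (hε : 0 < ε) :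
    ¬ HazardDetection.HazardSolvableInTime Set.univ ε ∧
    ¬ HazardDetection.HazardSolvableInTime {C | C.2.IsFormula ∧ C.2.depth = 4} ε ∧
    ¬ HazardDetection.HazardSolvableInTime {C | C.2.IsOrAndOrAnd} ε := by
  have h := HazardDetection.not_hazardSolvableInTime_isOrAndOrAnd hSETH hε
  exact ⟨fun h' => h (h'.mono (Set.subset_univ _)),
    fun h' => h (h'.mono fun _ hC => ⟨hC.1, hC.2.1⟩), h⟩
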